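/- Let $\prec$ be a well-order on $\mathbb{N}$. Let $\mathcal{L}_{\mathbb{N}}$ be the first-order language with a symbol for every function and every predicate on $\mathbb{N}$, and $\mathcal{L}_{\mathbb{N}}(X)$ its extension by a fresh unary predicate $X$. Formulas are in negation normal form; $\overline{\varphi}$ is the complement of $\varphi$. $\Delta_0(X)$ consists of the formulas with bounded quantifiers only; $p\Sigma_i(X)$ (resp. $p\Pi_i(X)$) consists of the formulas given by exactly $i$ alternating quantifiers, beginning with $\exists$ (resp. $\forall$), in front of a maximal $\Delta_0(X)$-subformula; $p\Sigma_i$ is its $X$-free part. Let $Th(\mathbb{N})$ be the set of true sentences in $\bigcup_i p\Sigma_i$, let $I\Sigma_1(X)$ be the theory $Th(\mathbb{N})$ plus the induction axioms for all $p\Sigma_1(X)$-formulas, and let $$TI(\prec)=\{\forall y.\, y\notin X,\ \ \exists x_0\forall x.\,(x_0\in X\wedge(x\notin X\vee \overline{x\prec x_0}))\},$$ a sequent, i.e. a finite set of formulas read as its disjunction. **Derivations.** An $I\Sigma_1(X)$-derivation of a sequent $S$ (free-cut-free, in free-variable normal form without redundancy) is a pair $\pi=(\tau,\lambda)$, where $\tau\subseteq\omega^{<\omega}$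 is a finite rooted tree (nonempty and closed under initial segments) and $\lambda$ labels its vertices by sequents, such that $\lambda(\emptyset)=S$ and every $\Gamma=\lambda(v)$ follows from the labels of the children of $v$, listed from left to right, by one of the rules: * Initial Sequent: no premise, if $L,\overline{L}\in\Gamma$ for a literal $L$. * $\vee$: premise $\Gamma,\varphi_i$, where $\varphi_1\vee\varphi_2\in\Gamma$ and $i\in\{1,2\}$. * $\wedge$: premises $\Gamma,\varphi_1$ and $\Gamma,\varphi_2$, where $\varphi_1\wedge\varphi_2\in\Gamma$. * $\exists$: premise $\Gamma,\varphi(u)$, where $\exists x.\varphi(x)\in\Gamma$ and $u$ is a term all of whose variables are free in $\Gamma$. * $\forall$: premise $\Gamma,\varphi(a)$, where $\forall x.\varphi(x)\in\Gamma$ and the variable $a$ is not free in $\Gamma$. * True Sentence: premise $\Gamma,\overline{\varphi}$, where $\varphi\in Th(\mathbb{N})$. * $p\Sigma_1(X)$-Cut: premises $\Gamma,\varphi$ and $\Gamma,\overline{\varphi}$, where $\varphi\in p\Sigma_1(X)$ and all free variables of $\varphi$ are free in $\Gamma$. * $p\Sigma_1(X)$-Induction: premises $\Gamma,\varphi(0)$;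 $\Gamma,\overline{\varphi(a)},\varphi(a+1)$; $\Gamma,\overline{\varphi(t)}$, where $\varphi(x)\in p\Sigma_1(X)$, $t$ is a term whose variables are free in $\varphi(t)$, the variable $a$ is not free in $\Gamma$, all free variables of $\varphi(0)$ and $\varphi(t)$ are free in $\Gamma$, and the free variables of the second premise are exactly those of $\Gamma$ together with $a$. Throughout, a formula added in a premise must not already be in $\Gamma$. The height of $\pi$ is $height(\tau)=\max_{v\in\tau}height(v)$, where $height(v)$ is the length of $v$. **The game $\mathcal{G}_1(\prec,h)$**, for $h\in\omega$. A position is a pair $(T,\rho)$ of a finite rooted tree $T\subseteq\omega^{<\omega}$ and a finite partial predicate $\rho$, i.e. a partial function $\mathbb{N}\rightharpoonup\{0,1\}$ with finite domain. Delayer chooses $m_0\in\mathbb{N}$, and the initial position is $(\{\emptyset\},\{m_0\mapsto 1\})$. At a position $(T,\rho)$, let $c(T)$ be the lexicographically least leaf of $T$. 1. Prover plays a finite $Q\subseteq\mathbb{N}$. 2. Delayer answers with a finite partial predicate $\rho'$ with $Q\subseteq\mathrm{dom}(\rho')$ such that for every $q\in Q$ with $\rho'(q)=1$ there is $p\prec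 q$ with $\rho'(p)=1$. If $\rho\cup\rho'$ is not a partial predicate, the game ends and Prover wins. 3. Otherwise Prover either * picks $b\in\omega$: put $T'=T\cup\{c(T)*i : 0\le i\le b\}$; if $height(T')>h$, the game ends and Prover loses; or * picks a proper initial segment $b$ of $c(T)$: write $c(T)=b*k*\sigma$ with $k\in\omega$; if $b*(k+1)\notin T$, the game ends and Prover loses; otherwise $T'$ is $T$ without $b*k$ and all its descendants. If the game has not ended, the next position is $(T',\rho\cup\rho')$. A strategy of a player gives the player's choices as functions of the play so far; a strategy of Prover is winning if, against every strategy of Delayer, the game ends after finitely many steps with Prover as the winner. **Theorem.** 1. If $\pi$ is an $I\Sigma_1(X)$-derivation (in the above sense) of $TI(\prec)$ of height $h$, then Prover has a winning strategy in $\mathcal{G}_1(\prec,h)$. 2. If the theory $I\Sigma_1(X)$ proves $TI(\prec)$ in first-order logic with equality, then there is an $I\Sigma_1(X)$-derivation $\pi$ of $TI(\prec)$ and, for $h$ its height, Prover has a winning strategy in $\mathcal{G}_1(\prec,h)$. In particular, there exists $h\in\omega$ such that Prover has a winning strategy in $\mathcal{G}_1(\prec,h)$. -/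

import Mathlib

namespace TIGame

/-! ### The language of all functions and predicates on the natural numbers -/

/-- The language with a symbol for every function and every predicate on `ℕ`, of every arity. -/
def LN : FirstOrder.Language.{0, 0} where
  Functions n := (Fin n → ℕ) → ℕ
  Relations n := (Fin n → ℕ) → Prop

/-- The standard model. -/
instance : LN.Structure ℕ where
  funMap f v := f v
  RelMap R v := R v

/-- Terms whose free variables are natural numbers `Sum.inl x`, and which may moreover contain the
bound variables `Sum.inr i` with `i < n` (de Bruijn indices, `0` is the innermost one). -/
abbrev Tm (n : ℕ) : Type := LN.Term (ℕ ⊕ Fin n)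

/-- A free variable. -/
def Tm.fvar {n : ℕ} (x : ℕ) : Tm n := FirstOrder.Language.Term.var (Sum.inl x)

/-- A bound variable. -/
def Tm.bvar {n : ℕ} (i : Fin n) : Tm n := FirstOrder.Language.Term.var (Sum.inr i)

/-- The numeral constant of value `m`. -/
def Tm.const {n : ℕ} (m : ℕ) : Tm n :=
  FirstOrder.Language.Term.func (L := LN) (l := 0) (fun _ => m) Fin.elim0

/-- The term `t + 1`. -/
def Tm.succ {n : ℕ} (t : Tm n) : Tm n :=
  FirstOrder.Language.Term.func (L := LN) (l := 2) (fun v => v 0 + v 1) ![t, Tm.const 1]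

/-- Passing below one more quantifier. -/
def Tm.lift {n : ℕ} (t : Tm n) : Tm (n + 1) := t.relabel (Sum.map id Fin.succ)

/-- The set of free variables of a term. -/
def Tm.fv {n : ℕ} (t : Tm n) : Set ℕ := {x | Sum.inl x ∈ t.varFinset}

/-! ### Formulas with the additional unary predicate `X`, in negation normal form -/

/-- Formulas of the language `LN` with a fresh unary predicate `X`, in negation normal form and up
to renaming of bound variables; `Fml 0` is the type of formulas proper, and `Fml 1` is the type of
formulas `φ(x)` with a distinguished variable `x`. -/
inductive Fml : ℕ → Type
  | rel {n l : ℕ} (R : LN.Relations l) (ts : Fin l → Tm n) : Fml n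
  | nrel {n l : ℕ} (R : LN.Relations l) (ts : Fin l → Tm n) : Fml n
  | memX {n : ℕ} (t : Tm n) : Fml n
  | nmemX {n : ℕ} (t : Tm n) : Fml n
  | and {n : ℕ} (φ ψ : Fml n) : Fml n
  | or {n : ℕ} (φ ψ : Fml n) : Fml n
  | all {n : ℕ} (φ : Fml (n + 1)) : Fml n
  | ex {n : ℕ} (φ : Fml (n + 1)) : Fml n

noncomputable instance (n : ℕ) : DecidableEq (Fml n) := Classical.decEq _

namespace Fml

/-- The complement: the canonical negation normal form of the negation. -/
def compl : {n : ℕ} → Fml n → Fml n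
  | _, rel R ts => nrel R ts
  | _, nrel R ts => rel R ts
  | _, memX t => nmemX t
  | _, nmemX t => memX t
  | _, and φ ψ => or φ.compl ψ.compl
  | _, or φ ψ => and φ.compl ψ.compl
  | _, all φ => ex φ.compl
  | _, ex φ => all φ.compl

/-- The set of free variables. -/
def fv : {n : ℕ} → Fml n → Set ℕ
  | _, rel _ ts => ⋃ i, (ts i).fv
  | _, nrel _ ts => ⋃ i, (ts i).fv
  | _, memX t => t.fv
  | _, nmemX t => t.fv
  | _, and φ ψ => φ.fv ∪ ψ.fv
  | _, or φ ψ => φ.fv ∪ ψ.fv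
  | _, all φ => φ.fv
  | _, ex φ => φ.fv

/-- The action of a substitution below a quantifier. -/
def liftSubst {n m : ℕ} (σ : ℕ ⊕ Fin n → Tm m) : ℕ ⊕ Fin (n + 1) → Tm (m + 1) :=
  Sum.elim (fun x => (σ (Sum.inl x)).lift)
    (Fin.cases (Tm.bvar 0) (fun i => (σ (Sum.inr i)).lift))

/-- Simultaneous capture-avoiding substitution. -/
def subst : {n m : ℕ} → (ℕ ⊕ Fin n → Tm m) → Fml n → Fml m
  | _, _, σ, rel R ts => rel R (fun i => (ts i).subst σ)
  | _, _, σ, nrel R ts => nrel R (fun i => (ts i).subst σ)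
  | _, _, σ, memX t => memX (t.subst σ)
  | _, _, σ, nmemX t => nmemX (t.subst σ)
  | _, _, σ, and φ ψ => and (φ.subst σ) (ψ.subst σ)
  | _, _, σ, or φ ψ => or (φ.subst σ) (ψ.subst σ)
  | _, _, σ, all φ => all (φ.subst (liftSubst σ))
  | _, _, σ, ex φ => ex (φ.subst (liftSubst σ))

/-- For `φ = φ(x)` and a term `u`, the formula `φ(u)`. -/
def inst {m : ℕ} (φ : Fml 1) (u : Tm m) : Fml m := φ.subst (Sum.elim Tm.fvar (fun _ => u))

/-- The formula is a literal. -/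
def IsLiteral {n : ℕ} : Fml n → Prop
  | rel _ _ => True
  | nrel _ _ => True
  | memX _ => True
  | nmemX _ => True
  | _ => False

/-- `X` does not occur in the formula. -/
def XFree : {n : ℕ} → Fml n → Prop
  | _, rel _ _ => True
  | _, nrel _ _ => True
  | _, memX _ => False
  | _, nmemX _ => False
  | _, and φ ψ => φ.XFree ∧ ψ.XFree
  | _, or φ ψ => φ.XFree ∧ ψ.XFree
  | _, all φ => φ.XFree
  | _, ex φ => φ.XFree

/-- Truth in the standard model, where `X` is interpreted by `χ`, the free variables by `e` and the
bound variables by `b`. -/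
def Holds (χ : Set ℕ) (e : ℕ → ℕ) : {n : ℕ} → (Fin n → ℕ) → Fml n → Prop
  | _, b, rel R ts => R (fun i => (ts i).realize (Sum.elim e b))
  | _, b, nrel R ts => ¬ R (fun i => (ts i).realize (Sum.elim e b))
  | _, b, memX t => t.realize (Sum.elim e b) ∈ χ
  | _, b, nmemX t => t.realize (Sum.elim e b) ∉ χ
  | _, b, and φ ψ => φ.Holds χ e b ∧ ψ.Holds χ e b
  | _, b, or φ ψ => φ.Holds χ e b ∨ ψ.Holds χ e b
  | _, b, all φ => ∀ x : ℕ, φ.Holds χ e (Fin.cons x b : Fin (_ + 1) → ℕ)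
  | _, b, ex φ => ∃ x : ℕ, φ.Holds χ e (Fin.cons x b : Fin (_ + 1) → ℕ)

/-- The atomic formula `s = t`. -/
def eq {n : ℕ} (s t : Tm n) : Fml n := rel (l := 2) (fun v => v 0 = v 1) ![s, t]

/-- The atomic formula `s ≤ t`. -/
def le {n : ℕ} (s t : Tm n) : Fml n := rel (l := 2) (fun v => v 0 ≤ v 1) ![s, t]

/-- The atomic formula `s ≺ t`. -/
def lt (prec : ℕ → ℕ → Prop) {n : ℕ} (s t : Tm n) : Fml n :=
  rel (l := 2) (fun v => prec (v 0) (v 1)) ![s, t]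

/-- `Δ₀(X)`: all quantifiers are bounded, that is, of the form `∀ x ≤ t. φ`, which is
`∀ x. (¬ x ≤ t ∨ φ)`, or `∃ x ≤ t. φ`, which is `∃ x. (x ≤ t ∧ φ)`, where `x` is not in `t`. -/
inductive IsDelta0 : {n : ℕ} → Fml n → Prop
  | literal {n : ℕ} (φ : Fml n) : φ.IsLiteral → IsDelta0 φ
  | and {n : ℕ} (φ ψ : Fml n) : IsDelta0 φ → IsDelta0 ψ → IsDelta0 (and φ ψ)
  | or {n : ℕ} (φ ψ : Fml n) : IsDelta0 φ → IsDelta0 ψ → IsDelta0 (or φ ψ)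
  | ball {n : ℕ} (t : Tm n) (φ : Fml (n + 1)) : IsDelta0 φ →
      IsDelta0 (all (or (le (Tm.bvar 0) t.lift).compl φ))
  | bex {n : ℕ} (t : Tm n) (φ : Fml (n + 1)) : IsDelta0 φ →
      IsDelta0 (ex (and (le (Tm.bvar 0) t.lift) φ))

/-- `IsPrenex true i` is the class `pΣᵢ(X)` and `IsPrenex false i` is the class `pΠᵢ(X)`: exactly
`i` alternating quantifiers, beginning with `∃` respectively `∀`, followed by a `Δ₀(X)`-formula
which is maximal, that is, prefixing it by the last of the `i` quantifiers leaves `Δ₀(X)`. -/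
inductive IsPrenex : Bool → ℕ → {n : ℕ} → Fml n → Prop
  | zero (s : Bool) {n : ℕ} (φ : Fml n) : IsDelta0 φ → IsPrenex s 0 φ
  | ex (i : ℕ) {n : ℕ} (φ : Fml (n + 1)) : IsPrenex false i φ → ¬ IsDelta0 (ex φ) →
      IsPrenex true (i + 1) (ex φ)
  | all (i : ℕ) {n : ℕ} (φ : Fml (n + 1)) : IsPrenex true i φ → ¬ IsDelta0 (all φ) →
      IsPrenex false (i + 1) (all φ)

/-- The class `pΣᵢ(X)`. -/
def IsPSigma (i : ℕ) {n : ℕ} (φ : Fml n) : Prop := IsPrenex true i φ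

end Fml

/-- `Th(ℕ)`: the true sentences without `X` in the union of the classes `pΣᵢ`. -/
def ThN : Set (Fml 0) :=
  {φ | φ.fv = ∅ ∧ φ.XFree ∧ (∃ i, φ.IsPSigma i) ∧ φ.Holds ∅ (fun _ => 0) Fin.elim0}

/-! ### The theory `IΣₖ(X)` -/

/-- A sequent is a finite set of formulas, read as its disjunction. -/
abbrev Sequent : Type := Finset (Fml 0)

/-- The set of free variables of a sequent. -/
def Sequent.fv (Γ : Sequent) : Set ℕ := ⋃ φ ∈ Γ, Fml.fv φ

/-- The induction axiom `φ(0) ∧ ∀ x. (φ(x) → φ(x + 1)) → ∀ x. φ(x)`, in negation normal form. -/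
def inductionAxiom (φ : Fml 1) : Fml 0 :=
  Fml.or (φ.inst (Tm.const 0)).compl
    (Fml.or (Fml.ex (Fml.and φ (φ.inst (Tm.bvar (n := 1) 0).succ).compl)) (Fml.all φ))

/-- The axioms of `IΣₖ(X)`: `Th(ℕ)` and induction for `pΣₖ(X)`-formulas (with parameters). -/
def ISigma (k : ℕ) : Set (Fml 0) := ThN ∪ {ψ | ∃ φ : Fml 1, φ.IsPSigma k ∧ ψ = inductionAxiom φ}

/-- Provability of a sequent from the (universal closures of the) formulas in `T`, in classical
first-order logic with equality, all cuts being allowed. -/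
inductive Proves (T : Set (Fml 0)) : Sequent → Prop
  | ofMem (φ : Fml 0) : φ ∈ T → Proves T {φ}
  | excludedMiddle (φ : Fml 0) : Proves T {φ, φ.compl}
  | eqRefl (t : Tm 0) : Proves T {Fml.eq t t}
  | eqSubst (φ : Fml 1) (s t : Tm 0) : Proves T {(Fml.eq s t).compl, (φ.inst s).compl, φ.inst t}
  | weaken (Γ Δ : Sequent) : Γ ⊆ Δ → Proves T Γ → Proves T Δ
  | orLeft (Γ : Sequent) (φ ψ : Fml 0) : Proves T (insert φ Γ) → Proves T (insert (φ.or ψ) Γ)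
  | orRight (Γ : Sequent) (φ ψ : Fml 0) : Proves T (insert ψ Γ) → Proves T (insert (φ.or ψ) Γ)
  | and (Γ : Sequent) (φ ψ : Fml 0) : Proves T (insert φ Γ) → Proves T (insert ψ Γ) →
      Proves T (insert (φ.and ψ) Γ)
  | ex (Γ : Sequent) (φ : Fml 1) (u : Tm 0) : Proves T (insert (φ.inst u) Γ) →
      Proves T (insert (Fml.ex φ) Γ)
  | all (Γ : Sequent) (φ : Fml 1) (a : ℕ) : a ∉ Sequent.fv Γ → a ∉ φ.fv →
      Proves T (insert (φ.inst (Tm.fvar a)) Γ) → Proves T (insert (Fml.all φ) Γ)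
  | cut (Γ : Sequent) (φ : Fml 0) : Proves T (insert φ Γ) → Proves T (insert φ.compl Γ) →
      Proves T Γ

/-- The sequent `TI(≺)`, with members `∀ y. y ∉ X` and
`∃ x₀ ∀ x. (x₀ ∈ X ∧ (x ∉ X ∨ ¬ x ≺ x₀))`. -/
noncomputable def TI (prec : ℕ → ℕ → Prop) : Sequent :=
  {Fml.all (Fml.nmemX (Tm.bvar 0)),
   Fml.ex (Fml.all (Fml.and (Fml.memX (Tm.bvar 1))
      (Fml.or (Fml.nmemX (Tm.bvar 0)) (Fml.lt prec (Tm.bvar 0) (Tm.bvar 1)).compl)))}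

/-! ### Finite trees of finite sequences -/

/-- A finite rooted tree: a nonempty finite set of finite sequences of natural numbers which is
closed under initial segments. -/
def IsTree (T : Finset (List ℕ)) : Prop :=
  T.Nonempty ∧ ∀ σ υ : List ℕ, σ <+: υ → υ ∈ T → σ ∈ T

/-- The height of a finite tree. -/
def treeHeight (T : Finset (List ℕ)) : ℕ := T.sup List.length

/-- The leaves of a tree. -/
def leaves (T : Finset (List ℕ)) : Set (List ℕ) := {v | v ∈ T ∧ ∀ k : ℕ, v ++ [k] ∉ T}

/-! ### The sequent calculus of `IΣₖ(X)` -/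

/-- `Rule k premises Γ`: the sequent `Γ` follows from the list of premises by one rule of the
calculus of free-cut-free `IΣₖ(X)`-derivations in free variable normal form without redundancy. -/
inductive Rule (k : ℕ) : List Sequent → Sequent → Prop
  | initial (Γ : Sequent) (L : Fml 0) : L.IsLiteral → L ∈ Γ → L.compl ∈ Γ → Rule k [] Γ
  | orLeft (Γ : Sequent) (φ ψ : Fml 0) : φ.or ψ ∈ Γ → φ ∉ Γ → Rule k [insert φ Γ] Γ
  | orRight (Γ : Sequent) (φ ψ : Fml 0) : φ.or ψ ∈ Γ → ψ ∉ Γ → Rule k [insert ψ Γ] Γ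
  | ex (Γ : Sequent) (φ : Fml 1) (u : Tm 0) : Fml.ex φ ∈ Γ → u.fv ⊆ Sequent.fv Γ →
      φ.inst u ∉ Γ → Rule k [insert (φ.inst u) Γ] Γ
  | and (Γ : Sequent) (φ ψ : Fml 0) : φ.and ψ ∈ Γ → φ ∉ Γ → ψ ∉ Γ →
      Rule k [insert φ Γ, insert ψ Γ] Γ
  | all (Γ : Sequent) (φ : Fml 1) (a : ℕ) : Fml.all φ ∈ Γ → a ∉ Sequent.fv Γ →
      φ.inst (Tm.fvar a) ∉ Γ → Rule k [insert (φ.inst (Tm.fvar a)) Γ] Γ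
  | trueSentence (Γ : Sequent) (φ : Fml 0) : φ ∈ ThN → φ.compl ∉ Γ →
      Rule k [insert φ.compl Γ] Γ
  | induction (Γ : Sequent) (φ : Fml 1) (a : ℕ) (t : Tm 0) : φ.IsPSigma k →
      t.fv ⊆ (φ.inst t).fv →
      φ.inst (Tm.const 0) ∉ Γ → (φ.inst t).compl ∉ Γ →
      a ∉ Sequent.fv Γ →
      Sequent.fv (insert (φ.inst (Tm.const 0)) Γ) = Sequent.fv Γ →
      Sequent.fv (insert (φ.inst t).compl Γ) = Sequent.fv Γ →
      Sequent.fv (insert (φ.inst (Tm.fvar a)).compl (insert (φ.inst (Tm.fvar a).succ) Γ)) =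
        Sequent.fv Γ ∪ {a} →
      Rule k [insert (φ.inst (Tm.const 0)) Γ,
        insert (φ.inst (Tm.fvar a)).compl (insert (φ.inst (Tm.fvar a).succ) Γ),
        insert (φ.inst t).compl Γ] Γ
  | cut (Γ : Sequent) (φ : Fml 0) : φ.IsPSigma k → φ ∉ Γ → φ.compl ∉ Γ →
      Sequent.fv (insert φ Γ) = Sequent.fv Γ → Sequent.fv (insert φ.compl Γ) = Sequent.fv Γ →
      Rule k [insert φ Γ, insert φ.compl Γ] Γ

/-- `(τ, lab)` is an `IΣₖ(X)`-derivation of `S`: at every vertex `v` of the finite tree `τ`, the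
label of `v` follows by a rule from the labels of the children of `v`, listed from left to right. -/
def IsDerivation (k : ℕ) (τ : Finset (List ℕ)) (lab : List ℕ → Sequent) (S : Sequent) : Prop :=
  IsTree τ ∧ lab [] = S ∧
    ∀ v ∈ τ, ∃ ks : List ℕ, ks.Pairwise (· < ·) ∧ (∀ j : ℕ, j ∈ ks ↔ v ++ [j] ∈ τ) ∧
      Rule k (ks.map fun j => lab (v ++ [j])) (lab v)

/-! ### The game -/

/-- Finite partial predicates on `ℕ`, given by their graphs. -/
def IsPartialPredicate (ρ : Finset (ℕ × Bool)) : Prop :=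
  ∀ x : ℕ, ¬ ((x, true) ∈ ρ ∧ (x, false) ∈ ρ)

/-- A position: the tree `T` and the graph `ρ` of the partial predicate recorded so far. -/
abbrev Position : Type := Finset (List ℕ) × Finset (ℕ × Bool)

/-- The second kind of move of Prover: `extend b` is `⟨0, b⟩` and `back b` is `⟨1, b⟩`. -/
inductive Move : Type
  | extend (b : ℕ)
  | back (b : List ℕ)

/-- `Next h T μ T'`: with current tree `T`, the move `μ` of Prover is legal, does not lose, and
leads to the tree `T'`. Here `c` is the leftmost leaf of `T`, that is, the lexicographically least
one. -/
inductive Next (h : ℕ) (T : Finset (List ℕ)) : Move → Finset (List ℕ) → Prop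
  | extend (c : List ℕ) (b : ℕ) : IsLeast (leaves T) c →
      treeHeight (T ∪ (Finset.range (b + 1)).image fun i => c ++ [i]) ≤ h →
      Next h T (Move.extend b) (T ∪ (Finset.range (b + 1)).image fun i => c ++ [i])
  | back (c b : List ℕ) (k : ℕ) (σ : List ℕ) : IsLeast (leaves T) c → c = b ++ [k] ++ σ →
      b ++ [k + 1] ∈ T → Next h T (Move.back b) (T.filter fun v => ¬ (b ++ [k]) <+: v)

/-- The answers `ρ'` that Delayer may give to the query `Q`. -/
def LegalAnswer (prec : ℕ → ℕ → Prop) (Q : Finset ℕ) (ρ' : Finset (ℕ × Bool)) : Prop :=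
  IsPartialPredicate ρ' ∧ (∀ q ∈ Q, ∃ i : Bool, (q, i) ∈ ρ') ∧
    ∀ q ∈ Q, (q, true) ∈ ρ' → ∃ p : ℕ, (p, true) ∈ ρ' ∧ prec p q

/-- A strategy of Prover; the plays `P₀, …, Pₗ` are lists of positions. -/
structure ProverStrategy where
  query : List Position → Finset ℕ
  move : List Position → Finset ℕ → Finset (ℕ × Bool) → Move

/-- A strategy of Delayer: the number `m₀` of the initial position, and the answers, which obey the
rules of the game. -/
structure DelayerStrategy (prec : ℕ → ℕ → Prop) where
  start : ℕ
  answer : List Position → Finset ℕ → Finset (ℕ × Bool)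
  legal : ∀ (play : List Position) (Q : Finset ℕ), LegalAnswer prec Q (answer play Q)

/-- `WinsFrom h f g past P`: if the play has gone through the positions `past` and is now at the
position `P`, then, with Prover following `f` and Delayer following `g`, the game ends after
finitely many further steps and Prover wins. -/
inductive WinsFrom {prec : ℕ → ℕ → Prop} (h : ℕ) (f : ProverStrategy) (g : DelayerStrategy prec) :
    List Position → Position → Prop
  | contradict (past : List Position) (T : Finset (List ℕ)) (ρ ρ' : Finset (ℕ × Bool))
      (Q : Finset ℕ) : Q = f.query (past ++ [(T, ρ)]) → ρ' = g.answer (past ++ [(T, ρ)]) Q →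
      ¬ IsPartialPredicate (ρ' ∪ ρ) → WinsFrom h f g past (T, ρ)
  | step (past : List Position) (T T' : Finset (List ℕ)) (ρ ρ' : Finset (ℕ × Bool))
      (Q : Finset ℕ) : Q = f.query (past ++ [(T, ρ)]) → ρ' = g.answer (past ++ [(T, ρ)]) Q →
      IsPartialPredicate (ρ' ∪ ρ) → Next h T (f.move (past ++ [(T, ρ)]) Q ρ') T' →
      WinsFrom h f g (past ++ [(T, ρ)]) (T', ρ' ∪ ρ) → WinsFrom h f g past (T, ρ)

/-- Prover has a winning strategy in the game `G₁(≺, h)`: one that wins against every strategy of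
Delayer, from the initial position chosen by the latter, which consists of the tree with the root
as its only vertex and the partial predicate `m₀ ↦ 1`. -/
def ProverWins (prec : ℕ → ℕ → Prop) (h : ℕ) : Prop :=
  ∃ f : ProverStrategy, ∀ g : DelayerStrategy prec,
    WinsFrom h f g [] ({[]}, {(g.start, true)})

end TIGame

/-!
The theorem consists of an analysis of derivations, which produces the strategy, and of a partial
cut elimination, which produces the derivation.

*From derivations to strategies* (`pw_of_deriv`). Prover walks through the derivation from the root
towards the leaves, with a value for each free variable, and keeps the current leaf of the tree of
the game matched with a vertex of the derivation of the same length. Formulas of the sequent there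
are refuted by the recorded partial predicate, in the strong Kleene sense `Fml.Ref`, with two
exceptions: the second member of `TI(≺)`, an instance of which is refuted by asking Delayer about
the term instantiated, and `pΣ₁(X)`-formulas `∃ x. θ` coming from a cut or an induction. For the
latter, every instance `θ(u)` met is decided by a query. If it is refuted, the walk goes on. If it
is verified, then Prover has found a witness and goes back to the inference which introduced the
formula, to its next premise, where the complement of the formula is now refuted. At an induction
whose term has the value `N` there are `N + 2` such premises, the second one being repeated for the
values `0, …, N - 1` of the eigenvariable. Initial sequents are never reached, as both literals
would be refuted; so the walk ends only when Delayer contradicts an earlier answer. That it ends is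
seen by induction on the height of the derivation, the way back being a continuation which is known
to win (`HasReturn`). Since the won positions are given inductively, ordinal ranks turn them into a
single strategy (`proverWins_of_forall_pw`).

*From proofs to derivations* (`pr_of_proves`, `derivable_TI_of_proves`). Cuts are eliminated
semantically, in the manner of phase semantics. Sets of sequents have an orthogonality `perp`
defined by derivability of unions, and each formula gets a closed set `Sem φ σ` as its truth value.
By `compl_mem_sem_and_pr_of_mem_sem` members of the value of `φ` make `φ` derivable, while cut is
sound because the value of the complement is the orthogonal. Axioms from `Th(ℕ)` are valid by the
rule for true sentences, and induction axioms by the rule of induction. The restrictions on free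
variables in the calculus are met by working with the class `Pr` of sequents all of whose instances
are derivable: superfluous variables are replaced by constants.

The calculus has no rule for equality. For formulas without `X` the equality axioms are true
sentences, but `s = t, s ∈ X ⊢ t ∈ X` is not available. So `t ∈ X` is first replaced by the
`Δ₀(X)`-formula `∃ y ≤ t. (t = y ∧ y ∈ X)` (`Fml.star`), for which the equality axioms are valid
(`transports_sem_star`), and `TI(≺)` for `X` is recovered from `TI(≺)` for the new predicate.
-/

namespace TIGame

open FirstOrder Language

/-! ### Substitution and free variables -/

theorem term_subst_congr {α β : Type} [DecidableEq α] (t : LN.Term α) {σ τ : α → LN.Term β}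
    (h : ∀ i ∈ t.varFinset, σ i = τ i) : t.subst σ = t.subst τ := by
  induction t with
  | var i => exact h i (by simp [Term.varFinset])
  | func f ts ih =>
    simp only [Term.subst, Term.func.injEq, heq_eq_eq, true_and]
    funext i
    exact ih i fun j hj => h j (by simpa [Term.varFinset] using ⟨i, hj⟩)

theorem term_subst_subst {α β γ : Type} (t : LN.Term α) (σ : α → LN.Term β)
    (τ : β → LN.Term γ) : (t.subst σ).subst τ = t.subst fun i => (σ i).subst τ := by
  induction t with
  | var i => rfl
  | func f ts ih =>
    simp only [Term.subst, Term.func.injEq, heq_eq_eq, true_and]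
    exact funext ih

theorem term_subst_var {α : Type} (t : LN.Term α) : t.subst Term.var = t := by
  induction t with
  | var i => rfl
  | func f ts ih =>
    simp only [Term.subst, Term.func.injEq, heq_eq_eq, true_and]
    exact funext ih

theorem term_relabel_eq_subst {α β : Type} (t : LN.Term α) (f : α → β) :
    t.relabel f = t.subst fun i => Term.var (f i) := by
  induction t with
  | var i => rfl
  | func f ts ih =>
    simp only [Term.subst, Term.relabel, Term.func.injEq, heq_eq_eq, true_and]
    exact funext ih

theorem mem_varFinset_subst {α β : Type} [DecidableEq α] [DecidableEq β] (t : LN.Term α)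
    (σ : α → LN.Term β) (x : β) :
    x ∈ (t.subst σ).varFinset ↔ ∃ i ∈ t.varFinset, x ∈ (σ i).varFinset := by
  induction t with
  | var i => simp [Term.subst, Term.varFinset]
  | func f ts ih =>
    simp only [Term.subst, Term.varFinset, Finset.mem_biUnion, Finset.mem_univ, true_and, ih]
    exact ⟨fun ⟨a, i, hi, h⟩ => ⟨i, ⟨a, hi⟩, h⟩, fun ⟨i, ⟨a, hi⟩, h⟩ => ⟨a, i, hi, h⟩⟩

theorem term_realize_congr {α : Type} [DecidableEq α] (t : LN.Term α) {v w : α → ℕ}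
    (h : ∀ i ∈ t.varFinset, v i = w i) : t.realize v = t.realize w := by
  induction t with
  | var i => exact h i (by simp [Term.varFinset])
  | func f ts ih =>
    simp only [Term.realize]
    congr 1
    funext i
    exact ih i fun j hj => h j (by simpa [Term.varFinset] using ⟨i, hj⟩)

namespace Tm

theorem lift_eq_subst {n : ℕ} (t : Tm n) :
    t.lift = t.subst (Sum.elim fvar fun i => bvar i.succ) := by
  rw [lift, term_relabel_eq_subst]
  congr 1
  funext i
  rcases i with x | i <;> rfl

@[simp] theorem fvar_subst {n m : ℕ} (x : ℕ) (σ : ℕ ⊕ Fin n → Tm m) :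
    (fvar x : Tm n).subst σ = σ (Sum.inl x) := rfl

@[simp] theorem bvar_subst {n m : ℕ} (i : Fin n) (σ : ℕ ⊕ Fin n → Tm m) :
    (bvar i : Tm n).subst σ = σ (Sum.inr i) := rfl

@[simp] theorem const_subst {n m k : ℕ} (σ : ℕ ⊕ Fin n → Tm m) :
    (const k : Tm n).subst σ = const k := by
  exact congrArg (Term.func (L := LN) (l := 0) fun _ => k) (funext fun i : Fin 0 => i.elim0)

@[simp] theorem succ_subst {n m : ℕ} (t : Tm n) (σ : ℕ ⊕ Fin n → Tm m) :
    t.succ.subst σ = succ (t.subst σ) := by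
  refine congrArg (Term.func (L := LN) (l := 2) fun v => v 0 + v 1) (funext fun i : Fin 2 => ?_)
  fin_cases i
  · rfl
  · exact const_subst σ

theorem lift_subst {n m : ℕ} (t : Tm n) (σ : ℕ ⊕ Fin (n + 1) → Tm m) :
    t.lift.subst σ = t.subst (Sum.elim (fun x => σ (Sum.inl x)) fun i => σ (Sum.inr i.succ)) := by
  rw [lift_eq_subst, term_subst_subst]
  congr 1
  funext i
  rcases i with x | i <;> rfl

@[simp] theorem lift_subst_liftSubst {n m : ℕ} (t : Tm n) (σ : ℕ ⊕ Fin n → Tm m) :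
    t.lift.subst (Fml.liftSubst σ) = lift (t.subst σ) := by
  rw [lift_subst, lift_eq_subst, term_subst_subst]
  congr 1
  funext i
  rcases i with x | i <;> simp [Fml.liftSubst, lift_eq_subst]

@[simp] theorem fv_fvar {n : ℕ} (x : ℕ) : (fvar x : Tm n).fv = {x} := by
  ext y; simp [fv, fvar, Term.varFinset]

@[simp] theorem fv_bvar {n : ℕ} (i : Fin n) : (bvar i : Tm n).fv = ∅ := by
  ext y; simp [fv, bvar, Term.varFinset]

@[simp] theorem fv_const {n : ℕ} (k : ℕ) : (const k : Tm n).fv = ∅ := by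
  ext y; simp [fv, const, Term.varFinset]

theorem mem_fv_subst {n m : ℕ} (t : Tm n) (σ : ℕ ⊕ Fin n → Tm m) (x : ℕ) :
    x ∈ fv (t.subst σ) ↔ ∃ i ∈ t.varFinset, x ∈ (σ i).fv :=
  mem_varFinset_subst t σ _

@[simp] theorem fv_lift {n : ℕ} (t : Tm n) : t.lift.fv = t.fv := by
  ext x
  rw [lift_eq_subst, mem_fv_subst]
  constructor
  · rintro ⟨y | i, hi, h⟩
    · simp only [Sum.elim_inl, fv_fvar, Set.mem_singleton_iff] at h
      subst h; exact hi
    · simp at h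
  · intro h
    exact ⟨Sum.inl x, h, by simp⟩

@[simp] theorem fv_succ {n : ℕ} (t : Tm n) : t.succ.fv = t.fv := by
  ext x
  simp [fv, succ, Term.varFinset, Fin.exists_fin_two, const]

theorem finite_fv {n : ℕ} (t : Tm n) : t.fv.Finite :=
  (t.varFinset.finite_toSet.preimage Sum.inl_injective.injOn : _)

@[simp] theorem realize_fvar {n : ℕ} (x : ℕ) (v : ℕ ⊕ Fin n → ℕ) :
    (fvar x : Tm n).realize v = v (Sum.inl x) := rfl

@[simp] theorem realize_bvar {n : ℕ} (i : Fin n) (v : ℕ ⊕ Fin n → ℕ) :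
    (bvar i : Tm n).realize v = v (Sum.inr i) := rfl

@[simp] theorem realize_const {n : ℕ} (k : ℕ) (v : ℕ ⊕ Fin n → ℕ) :
    (const k : Tm n).realize v = k := rfl

@[simp] theorem realize_succ {n : ℕ} (t : Tm n) (v : ℕ ⊕ Fin n → ℕ) :
    t.succ.realize v = t.realize v + 1 := rfl

@[simp] theorem realize_lift {n : ℕ} (t : Tm n) (e : ℕ → ℕ) (x : ℕ) (b : Fin n → ℕ) :
    t.lift.realize (Sum.elim e (Fin.cons x b : Fin (n + 1) → ℕ)) = t.realize (Sum.elim e b) := by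
  rw [lift, Term.realize_relabel]
  congr 1
  funext i
  rcases i with x | i <;> rfl

end Tm

namespace Fml

/-- The variables, free or bound further outside, which occur in a formula. -/
def vars : {n : ℕ} → Fml n → Set (ℕ ⊕ Fin n)
  | _, rel _ ts => {i | ∃ j, i ∈ (ts j).varFinset}
  | _, nrel _ ts => {i | ∃ j, i ∈ (ts j).varFinset}
  | _, memX t => {i | i ∈ t.varFinset}
  | _, nmemX t => {i | i ∈ t.varFinset}
  | _, and φ ψ => φ.vars ∪ ψ.vars
  | _, or φ ψ => φ.vars ∪ ψ.vars
  | _, all φ => {i | Sum.map id Fin.succ i ∈ φ.vars}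
  | _, ex φ => {i | Sum.map id Fin.succ i ∈ φ.vars}

theorem mem_fv_iff {n : ℕ} (φ : Fml n) (x : ℕ) : x ∈ φ.fv ↔ Sum.inl x ∈ φ.vars := by
  induction φ with
  | rel R ts => simp [fv, vars, Tm.fv]
  | nrel R ts => simp [fv, vars, Tm.fv]
  | memX t => simp [fv, vars, Tm.fv]
  | nmemX t => simp [fv, vars, Tm.fv]
  | and φ ψ h1 h2 => simp [fv, vars, h1, h2]
  | or φ ψ h1 h2 => simp [fv, vars, h1, h2]
  | all φ h => simp [fv, vars, h]
  | ex φ h => simp [fv, vars, h]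

theorem liftSubst_congr {n m : ℕ} {V : Set (ℕ ⊕ Fin (n + 1))} {σ τ : ℕ ⊕ Fin n → Tm m}
    (h : ∀ i, Sum.map id Fin.succ i ∈ V → σ i = τ i) :
    ∀ i ∈ V, liftSubst σ i = liftSubst τ i := by
  rintro (x | i) hi
  · simp [liftSubst, h (Sum.inl x) hi]
  · induction i using Fin.cases with
    | zero => rfl
    | succ i => simp [liftSubst, h (Sum.inr i) hi]

theorem subst_congr {n m : ℕ} (φ : Fml n) {σ τ : ℕ ⊕ Fin n → Tm m}
    (h : ∀ i ∈ φ.vars, σ i = τ i) : φ.subst σ = φ.subst τ := by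
  induction φ generalizing m with
  | rel R ts =>
    simp only [subst, rel.injEq, heq_eq_eq, true_and]
    exact funext fun j => term_subst_congr _ fun i hi => h i ⟨j, hi⟩
  | nrel R ts =>
    simp only [subst, nrel.injEq, heq_eq_eq, true_and]
    exact funext fun j => term_subst_congr _ fun i hi => h i ⟨j, hi⟩
  | memX t => simp only [subst, term_subst_congr _ h]
  | nmemX t => simp only [subst, term_subst_congr _ h]
  | and φ ψ h1 h2 =>
    simp only [subst, h1 fun i hi => h i (Or.inl hi), h2 fun i hi => h i (Or.inr hi)]
  | or φ ψ h1 h2 =>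
    simp only [subst, h1 fun i hi => h i (Or.inl hi), h2 fun i hi => h i (Or.inr hi)]
  | all φ ih => simp only [subst, ih (liftSubst_congr h)]
  | ex φ ih => simp only [subst, ih (liftSubst_congr h)]

theorem liftSubst_comp {n m k : ℕ} (σ : ℕ ⊕ Fin n → Tm m) (τ : ℕ ⊕ Fin m → Tm k) :
    (fun i => (liftSubst σ i).subst (liftSubst τ)) = liftSubst fun i => (σ i).subst τ := by
  funext i
  rcases i with x | i
  · exact Tm.lift_subst_liftSubst _ _
  · induction i using Fin.cases with
    | zero => rfl
    | succ i => exact Tm.lift_subst_liftSubst _ _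

theorem subst_subst {n m k : ℕ} (φ : Fml n) (σ : ℕ ⊕ Fin n → Tm m) (τ : ℕ ⊕ Fin m → Tm k) :
    (φ.subst σ).subst τ = φ.subst fun i => (σ i).subst τ := by
  induction φ generalizing m k with
  | rel R ts => simp only [subst, term_subst_subst]
  | nrel R ts => simp only [subst, term_subst_subst]
  | memX t => simp only [subst, term_subst_subst]
  | nmemX t => simp only [subst, term_subst_subst]
  | and φ ψ h1 h2 => simp only [subst, h1, h2]
  | or φ ψ h1 h2 => simp only [subst, h1, h2]
  | all φ ih => simp only [subst, ih, liftSubst_comp]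
  | ex φ ih => simp only [subst, ih, liftSubst_comp]

theorem liftSubst_var {n : ℕ} : liftSubst (fun i : ℕ ⊕ Fin n => Term.var i) = Term.var := by
  funext i
  rcases i with x | i
  · rfl
  · induction i using Fin.cases with
    | zero => rfl
    | succ i => rfl

theorem subst_var {n : ℕ} (φ : Fml n) : φ.subst Term.var = φ := by
  induction φ with
  | rel R ts => simp only [subst, term_subst_var]
  | nrel R ts => simp only [subst, term_subst_var]
  | memX t => simp only [subst, term_subst_var]
  | nmemX t => simp only [subst, term_subst_var]
  | and φ ψ h1 h2 => simp only [subst, h1, h2]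
  | or φ ψ h1 h2 => simp only [subst, h1, h2]
  | all φ ih => exact congrArg all ((congrArg (φ.subst ·) liftSubst_var).trans ih)
  | ex φ ih => exact congrArg ex ((congrArg (φ.subst ·) liftSubst_var).trans ih)

/-- Variables may also be introduced by the terms put for bound variables of the context, which
is why `vars` and not `fv` occurs here. -/
theorem mem_fv_subst {n m : ℕ} (φ : Fml n) (σ : ℕ ⊕ Fin n → Tm m) (x : ℕ) :
    x ∈ (φ.subst σ).fv ↔ ∃ i ∈ φ.vars, x ∈ (σ i).fv := by
  have key : ∀ {n m : ℕ} (V : Set (ℕ ⊕ Fin (n + 1))) (σ : ℕ ⊕ Fin n → Tm m),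
      (∃ i ∈ V, x ∈ (liftSubst σ i).fv) ↔ ∃ i, Sum.map id Fin.succ i ∈ V ∧ x ∈ (σ i).fv := by
    intro n m V σ
    constructor
    · rintro ⟨y | i, hi, h⟩
      · exact ⟨Sum.inl y, hi, by simpa [liftSubst] using h⟩
      · induction i using Fin.cases with
        | zero => simp [liftSubst] at h
        | succ i => exact ⟨Sum.inr i, hi, by simpa [liftSubst] using h⟩
    · rintro ⟨y | i, hi, h⟩
      · exact ⟨_, hi, by simpa [liftSubst] using h⟩
      · exact ⟨_, hi, by simpa [liftSubst] using h⟩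
  induction φ generalizing m with
  | rel R ts =>
    simp only [subst, fv, vars, Set.mem_iUnion, Tm.mem_fv_subst, Set.mem_ofPred_eq]
    exact ⟨fun ⟨a, i, hi, h⟩ => ⟨i, ⟨a, hi⟩, h⟩, fun ⟨i, ⟨a, hi⟩, h⟩ => ⟨a, i, hi, h⟩⟩
  | nrel R ts =>
    simp only [subst, fv, vars, Set.mem_iUnion, Tm.mem_fv_subst, Set.mem_ofPred_eq]
    exact ⟨fun ⟨a, i, hi, h⟩ => ⟨i, ⟨a, hi⟩, h⟩, fun ⟨i, ⟨a, hi⟩, h⟩ => ⟨a, i, hi, h⟩⟩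
  | memX t => exact Tm.mem_fv_subst _ _ _
  | nmemX t => exact Tm.mem_fv_subst _ _ _
  | and φ ψ h1 h2 => simp only [subst, fv, vars, Set.mem_union, h1, h2, or_and_right, exists_or]
  | or φ ψ h1 h2 => simp only [subst, fv, vars, Set.mem_union, h1, h2, or_and_right, exists_or]
  | all φ ih => simp only [subst, fv, vars, ih, key, Set.mem_ofPred_eq]
  | ex φ ih => simp only [subst, fv, vars, ih, key, Set.mem_ofPred_eq]

theorem finite_fv {n : ℕ} (φ : Fml n) : φ.fv.Finite := by
  induction φ with
  | rel R ts => exact Set.finite_iUnion fun i => Tm.finite_fv _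
  | nrel R ts => exact Set.finite_iUnion fun i => Tm.finite_fv _
  | memX t => exact Tm.finite_fv _
  | nmemX t => exact Tm.finite_fv _
  | and φ ψ h1 h2 => exact h1.union h2
  | or φ ψ h1 h2 => exact h1.union h2
  | all φ ih => exact ih
  | ex φ ih => exact ih

theorem subst_compl {n m : ℕ} (φ : Fml n) (σ : ℕ ⊕ Fin n → Tm m) :
    (φ.subst σ).compl = φ.compl.subst σ := by
  induction φ generalizing m with
  | rel R ts => rfl
  | nrel R ts => rfl
  | memX t => rfl
  | nmemX t => rfl
  | and φ ψ h1 h2 => simp only [subst, compl, h1, h2]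
  | or φ ψ h1 h2 => simp only [subst, compl, h1, h2]
  | all φ ih => simp only [subst, compl, ih]
  | ex φ ih => simp only [subst, compl, ih]

@[simp] theorem compl_compl {n : ℕ} (φ : Fml n) : φ.compl.compl = φ := by
  induction φ with
  | rel R ts => rfl
  | nrel R ts => rfl
  | memX t => rfl
  | nmemX t => rfl
  | and φ ψ h1 h2 => simp only [compl, h1, h2]
  | or φ ψ h1 h2 => simp only [compl, h1, h2]
  | all φ ih => simp only [compl, ih]
  | ex φ ih => simp only [compl, ih]

@[simp] theorem fv_compl {n : ℕ} (φ : Fml n) : φ.compl.fv = φ.fv := by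
  induction φ with
  | rel R ts => rfl
  | nrel R ts => rfl
  | memX t => rfl
  | nmemX t => rfl
  | and φ ψ h1 h2 => simp only [fv, compl, h1, h2]
  | or φ ψ h1 h2 => simp only [fv, compl, h1, h2]
  | all φ ih => simp only [fv, compl, ih]
  | ex φ ih => simp only [fv, compl, ih]

theorem inst_compl {m : ℕ} (φ : Fml 1) (u : Tm m) : (φ.inst u).compl = φ.compl.inst u :=
  subst_compl _ _

theorem inst_subst {k m : ℕ} (φ : Fml 1) (u : Tm m) (σ : ℕ ⊕ Fin m → Tm k) :
    (φ.inst u).subst σ =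
      φ.subst (Sum.elim (fun x => σ (Sum.inl x)) fun _ => u.subst σ) := by
  rw [inst, subst_subst]
  congr 1
  funext i
  rcases i with x | i <;> rfl

@[simp] theorem subst_rel₂ {n m : ℕ} (R : LN.Relations 2) (s t : Tm n) (σ : ℕ ⊕ Fin n → Tm m) :
    (rel R ![s, t]).subst σ = rel R ![s.subst σ, t.subst σ] := by
  simp only [subst, rel.injEq, heq_eq_eq, true_and]
  funext i
  fin_cases i <;> rfl

theorem subst_le {n m : ℕ} (s t : Tm n) (σ : ℕ ⊕ Fin n → Tm m) :
    (le s t).subst σ = le (s.subst σ) (t.subst σ) := subst_rel₂ _ _ _ _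

theorem subst_eq {n m : ℕ} (s t : Tm n) (σ : ℕ ⊕ Fin n → Tm m) :
    (eq s t).subst σ = eq (s.subst σ) (t.subst σ) := subst_rel₂ _ _ _ _

theorem subst_lt (prec : ℕ → ℕ → Prop) {n m : ℕ} (s t : Tm n) (σ : ℕ ⊕ Fin n → Tm m) :
    (lt prec s t).subst σ = lt prec (s.subst σ) (t.subst σ) := subst_rel₂ _ _ _ _

theorem IsLiteral.subst {n m : ℕ} {φ : Fml n} (h : φ.IsLiteral) (σ : ℕ ⊕ Fin n → Tm m) :
    (φ.subst σ).IsLiteral := by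
  cases φ <;> simp_all [IsLiteral, Fml.subst]

theorem IsDelta0.subst {n m : ℕ} {φ : Fml n} (h : φ.IsDelta0) (σ : ℕ ⊕ Fin n → Tm m) :
    (φ.subst σ).IsDelta0 := by
  induction h generalizing m with
  | literal φ h => exact .literal _ (h.subst σ)
  | and φ ψ _ _ h1 h2 => exact .and _ _ (h1 σ) (h2 σ)
  | or φ ψ _ _ h1 h2 => exact .or _ _ (h1 σ) (h2 σ)
  | ball t φ _ ih =>
    have := IsDelta0.ball (t.subst σ) _ (ih (liftSubst σ))
    simpa only [Fml.subst, ← subst_compl, subst_le, Tm.lift_subst_liftSubst, Tm.bvar_subst]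
  | bex t φ _ ih =>
    have := IsDelta0.bex (t.subst σ) _ (ih (liftSubst σ))
    simpa only [Fml.subst, ← subst_compl, subst_le, Tm.lift_subst_liftSubst, Tm.bvar_subst]

theorem IsDelta0.compl {n : ℕ} {φ : Fml n} (h : φ.IsDelta0) : φ.compl.IsDelta0 := by
  induction h with
  | literal φ h => exact .literal _ (by cases φ <;> simp_all [IsLiteral, Fml.compl])
  | and φ ψ _ _ h1 h2 => exact .or _ _ h1 h2
  | or φ ψ _ _ h1 h2 => exact .and _ _ h1 h2
  | ball t φ _ ih => simpa only [Fml.compl, compl_compl] using IsDelta0.bex t _ ih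
  | bex t φ _ ih => simpa only [Fml.compl, compl_compl] using IsDelta0.ball t _ ih

theorem isDelta0_and_right {n : ℕ} {φ ψ : Fml n} (h : (and φ ψ).IsDelta0) : ψ.IsDelta0 := by
  cases h with
  | literal _ h => exact h.elim
  | and _ _ _ h => exact h

theorem isDelta0_ex_iff {n : ℕ} (θ : Fml (n + 1)) :
    (ex θ).IsDelta0 ↔
      ∃ (t : Tm n) (ψ : Fml (n + 1)), ψ.IsDelta0 ∧ θ = and (le (Tm.bvar 0) t.lift) ψ := by
  constructor
  · intro h
    cases h with
    | literal _ h => exact h.elim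
    | bex t φ h => exact ⟨t, φ, h, rfl⟩
  · rintro ⟨t, ψ, h, rfl⟩
    exact .bex t ψ h

/-- A term whose image under a substitution acting below a quantifier avoids the variable of that
quantifier avoids this variable itself. -/
theorem exists_lift_of_subst_eq_lift {n m : ℕ} (s : Tm (n + 1)) (t : Tm m)
    (σ : ℕ ⊕ Fin n → Tm m) (h : s.subst (liftSubst σ) = t.lift) : ∃ r : Tm n, s = r.lift := by
  have h0 : Sum.inr 0 ∉ s.varFinset := by
    intro h0
    have : Sum.inr 0 ∈ t.lift.varFinset := by
      rw [← h, mem_varFinset_subst]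
      exact ⟨_, h0, by simp [liftSubst, Tm.bvar, Term.varFinset]⟩
    rw [Tm.lift_eq_subst, mem_varFinset_subst] at this
    obtain ⟨x | i, _, h⟩ := this
    · simp [Tm.fvar, Term.varFinset] at h
    · simp only [Sum.elim_inr, Tm.bvar, Term.varFinset, Finset.mem_singleton, Sum.inr.injEq] at h
      exact Fin.succ_ne_zero i h.symm
  refine ⟨s.subst (Sum.elim Tm.fvar (Fin.cases (Tm.const 0) Tm.bvar)), ?_⟩
  rw [Tm.lift_eq_subst, term_subst_subst]
  conv_lhs => rw [← term_subst_var s]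
  apply term_subst_congr
  rintro (x | i) hi
  · rfl
  · induction i using Fin.cases with
    | zero => exact absurd hi h0
    | succ i => rfl

/-- Substitution does not turn an unbounded quantifier into a bounded one. -/
theorem isDelta0_of_subst_ex {n m : ℕ} {θ : Fml (n + 1)} (hθ : θ.IsDelta0)
    (σ : ℕ ⊕ Fin n → Tm m) (h : ((ex θ).subst σ).IsDelta0) : (ex θ).IsDelta0 := by
  obtain ⟨t, ψ, -, h⟩ := (isDelta0_ex_iff _).1 h
  rw [isDelta0_ex_iff]
  cases θ with
  | and A B =>
    simp only [subst, and.injEq] at h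
    cases A with
    | rel R ts =>
      obtain ⟨h, -⟩ := h
      simp only [subst, le] at h
      injection h with h1 h2 h3 h4
      subst h2
      have h3 : R = fun v => v 0 ≤ v 1 := eq_of_heq h3
      have h4 := eq_of_heq h4
      subst h3
      have h0 := congrFun h4 0
      have h1 := congrFun h4 1
      obtain ⟨r, hr⟩ := exists_lift_of_subst_eq_lift _ _ _ h1
      refine ⟨r, B, isDelta0_and_right hθ, ?_⟩
      refine congrArg (fun ts => and (rel (l := 2) _ ts) B) (funext fun i => ?_)
      refine Fin.cases ?_ (fun i => ?_) i
      · show ts 0 = Tm.bvar 0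
        generalize ts 0 = s at h0
        cases s with
        | var i =>
          rcases i with x | i
          · simp only [Term.subst, liftSubst, Sum.elim_inl, Tm.lift_eq_subst] at h0
            generalize σ (Sum.inl x) = u at h0
            cases u with
            | var j =>
              rcases j with j | j
              · simp [Term.subst, Tm.fvar, Tm.bvar] at h0
              · simp only [Term.subst, Sum.elim_inr, Tm.bvar, Matrix.cons_val_zero,
                  Term.var.injEq, Sum.inr.injEq] at h0
                exact absurd h0 (Fin.succ_ne_zero j)
            | func f us => simp [Term.subst, Tm.bvar] at h0
          · induction i using Fin.cases with
            | zero => rfl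
            | succ i =>
              simp only [Term.subst, liftSubst, Sum.elim_inr, Fin.cases_succ,
                Tm.lift_eq_subst] at h0
              generalize σ (Sum.inr i) = u at h0
              cases u with
              | var j =>
                rcases j with j | j
                · simp [Term.subst, Tm.fvar, Tm.bvar] at h0
                · simp only [Term.subst, Sum.elim_inr, Tm.bvar, Matrix.cons_val_zero,
                    Term.var.injEq, Sum.inr.injEq] at h0
                  exact absurd h0 (Fin.succ_ne_zero j)
              | func f us => simp [Term.subst, Tm.bvar] at h0
        | func f us => simp [Term.subst, Tm.bvar] at h0
      · have : i = 0 := Subsingleton.elim _ _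
        subst this
        exact hr
    | _ => simp [subst, le] at h
  | _ => simp [subst] at h

theorem isPSigma_one_iff {n : ℕ} (φ : Fml n) :
    φ.IsPSigma 1 ↔ ∃ θ, θ.IsDelta0 ∧ φ = ex θ ∧ ¬ (ex θ).IsDelta0 := by
  constructor
  · intro h
    cases h with
    | ex i θ h1 h2 =>
      cases h1 with
      | zero _ _ h => exact ⟨θ, h, rfl, h2⟩
  · rintro ⟨θ, h, rfl, h2⟩
    exact .ex 0 θ (.zero _ _ h) h2

theorem IsPSigma.subst {n m : ℕ} {φ : Fml n} (h : φ.IsPSigma 1) (σ : ℕ ⊕ Fin n → Tm m) :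
    (φ.subst σ).IsPSigma 1 := by
  rw [isPSigma_one_iff] at h
  obtain ⟨θ, hθ, rfl, h⟩ := h
  exact (isPSigma_one_iff _).2
    ⟨_, hθ.subst _, rfl, fun h' => h (isDelta0_of_subst_ex hθ σ h')⟩

theorem realize_liftSubst {n m : ℕ} {e e' : ℕ → ℕ} {b : Fin m → ℕ} {σ : ℕ ⊕ Fin n → Tm m}
    {b' : Fin n → ℕ} (x : ℕ) (h : ∀ i, (σ i).realize (Sum.elim e b) = Sum.elim e' b' i)
    (i : ℕ ⊕ Fin (n + 1)) :
    (liftSubst σ i).realize (Sum.elim e (Fin.cons x b : Fin (m + 1) → ℕ)) =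
      Sum.elim e' (Fin.cons x b' : Fin (n + 1) → ℕ) i := by
  rcases i with y | i
  · simpa [liftSubst] using h (Sum.inl y)
  · induction i using Fin.cases with
    | zero => rfl
    | succ i => simpa [liftSubst] using h (Sum.inr i)

theorem holds_subst {n m : ℕ} (χ : Set ℕ) (e : ℕ → ℕ) (b : Fin m → ℕ) (φ : Fml n)
    (σ : ℕ ⊕ Fin n → Tm m) (e' : ℕ → ℕ) (b' : Fin n → ℕ)
    (h : ∀ i, (σ i).realize (Sum.elim e b) = Sum.elim e' b' i) :
    (φ.subst σ).Holds χ e b ↔ φ.Holds χ e' b' := by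
  have hterm : (fun i => (σ i).realize (Sum.elim e b)) = Sum.elim e' b' := funext h
  induction φ generalizing m with
  | rel R ts => simp only [subst, Holds, Term.realize_subst, hterm]
  | nrel R ts => simp only [subst, Holds, Term.realize_subst, hterm]
  | memX t => simp only [subst, Holds, Term.realize_subst, hterm]
  | nmemX t => simp only [subst, Holds, Term.realize_subst, hterm]
  | and φ ψ h1 h2 => simp only [subst, Holds, h1 b σ b' h hterm, h2 b σ b' h hterm]
  | or φ ψ h1 h2 => simp only [subst, Holds, h1 b σ b' h hterm, h2 b σ b' h hterm]
  | all φ ih =>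
    simp only [subst, Holds]
    exact forall_congr' fun x => ih _ _ _ (realize_liftSubst x h) (funext (realize_liftSubst x h))
  | ex φ ih =>
    simp only [subst, Holds]
    exact exists_congr fun x => ih _ _ _ (realize_liftSubst x h) (funext (realize_liftSubst x h))

end Fml

namespace Sequent

theorem mem_fv {Γ : Sequent} {x : ℕ} : x ∈ fv Γ ↔ ∃ φ ∈ Γ, x ∈ φ.fv := by
  simp [fv]

theorem fv_insert (φ : Fml 0) (Γ : Sequent) : fv (insert φ Γ) = φ.fv ∪ fv Γ := by
  ext x; simp [mem_fv]

theorem exists_notMem_fv (Γ : Sequent) : ∃ a, a ∉ fv Γ :=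
  (Set.Finite.biUnion Γ.finite_toSet fun φ _ => φ.finite_fv).exists_notMem

end Sequent

/-! ### Derivations of bounded height -/

/-- `Deriv n Γ`: the sequent `Γ` has an `IΣ₁(X)`-derivation of height at most `n`. -/
def Deriv : ℕ → Sequent → Prop
  | 0, Γ => Rule 1 [] Γ
  | n + 1, Γ => ∃ ps : List Sequent, Rule 1 ps Γ ∧ ∀ p ∈ ps, Deriv n p

theorem Deriv.succ {n : ℕ} {Γ : Sequent} (h : Deriv n Γ) : Deriv (n + 1) Γ := by
  induction n generalizing Γ with
  | zero => exact ⟨[], h, by simp⟩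
  | succ n ih =>
    obtain ⟨ps, h1, h2⟩ := h
    exact ⟨ps, h1, fun p hp => ih (h2 p hp)⟩

theorem Deriv.mono {n m : ℕ} {Γ : Sequent} (h : Deriv n Γ) (hnm : n ≤ m) : Deriv m Γ := by
  induction hnm with
  | refl => exact h
  | step _ ih => exact ih.succ

theorem Deriv.of_isDerivation {τ : Finset (List ℕ)} {lab : List ℕ → Sequent} {S : Sequent}
    (h : IsDerivation 1 τ lab S) : Deriv (treeHeight τ) S := by
  obtain ⟨⟨⟨w, hw⟩, htree⟩, rfl, hrule⟩ := h
  suffices H : ∀ n v, v ∈ τ → v.length + n = treeHeight τ → Deriv n (lab v) from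
    H _ [] (htree _ _ List.nil_prefix hw) (by simp)
  intro n
  induction n with
  | zero =>
    intro v hv hn
    obtain ⟨ks, -, hks, h⟩ := hrule v hv
    have : ks = [] := by
      rw [List.eq_nil_iff_forall_not_mem]
      intro j hj
      have := Finset.le_sup (f := List.length) ((hks j).1 hj)
      rw [List.length_append] at this
      simp only [List.length_singleton] at this
      unfold treeHeight at hn
      omega
    subst this
    exact h
  | succ n ih =>
    intro v hv hn
    obtain ⟨ks, -, hks, h⟩ := hrule v hv
    refine ⟨_, h, fun p hp => ?_⟩
    obtain ⟨j, hj, rfl⟩ := List.mem_map.1 hp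
    exact ih _ ((hks j).1 hj) (by simp; omega)

/-! ### Refutation by finite partial predicates -/

namespace Fml

/-- The finite partial predicate with graph `ρ` refutes the formula, under the values `e` of the
free and `b` of the bound variables: falsity in the strong Kleene sense, so that a universal
formula needs a witness and a conjunction a refuted member. -/
def Ref (ρ : Finset (ℕ × Bool)) (e : ℕ → ℕ) : {n : ℕ} → (Fin n → ℕ) → Fml n → Prop
  | _, b, rel R ts => ¬ R (fun i => (ts i).realize (Sum.elim e b))
  | _, b, nrel R ts => R (fun i => (ts i).realize (Sum.elim e b))
  | _, b, memX t => (t.realize (Sum.elim e b), false) ∈ ρ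
  | _, b, nmemX t => (t.realize (Sum.elim e b), true) ∈ ρ
  | _, b, and φ ψ => φ.Ref ρ e b ∨ ψ.Ref ρ e b
  | _, b, or φ ψ => φ.Ref ρ e b ∧ ψ.Ref ρ e b
  | _, b, all φ => ∃ x : ℕ, φ.Ref ρ e (Fin.cons x b : Fin (_ + 1) → ℕ)
  | _, b, ex φ => ∀ x : ℕ, φ.Ref ρ e (Fin.cons x b : Fin (_ + 1) → ℕ)

theorem Ref.mono {ρ ρ' : Finset (ℕ × Bool)} (h : ρ ⊆ ρ') {e : ℕ → ℕ} {n : ℕ} {b : Fin n → ℕ}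
    {φ : Fml n} (hφ : φ.Ref ρ e b) : φ.Ref ρ' e b := by
  induction φ with
  | rel R ts => exact hφ
  | nrel R ts => exact hφ
  | memX t => exact h hφ
  | nmemX t => exact h hφ
  | and φ ψ h1 h2 => exact hφ.imp h1 h2
  | or φ ψ h1 h2 => exact ⟨h1 hφ.1, h2 hφ.2⟩
  | all φ ih => exact hφ.imp fun x hx => ih hx
  | ex φ ih => exact fun x => ih (hφ x)

theorem ref_congr (ρ : Finset (ℕ × Bool)) {e e' : ℕ → ℕ} {n : ℕ} (b : Fin n → ℕ) (φ : Fml n)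
    (h : ∀ x ∈ φ.fv, e x = e' x) : φ.Ref ρ e b ↔ φ.Ref ρ e' b := by
  have term : ∀ {n : ℕ} (b : Fin n → ℕ) (t : Tm n), (∀ x ∈ t.fv, e x = e' x) →
      t.realize (Sum.elim e b) = t.realize (Sum.elim e' b) := by
    intro n b t h
    refine term_realize_congr t ?_
    rintro (x | i) hi
    · exact h x hi
    · rfl
  induction φ with
  | rel R ts =>
    have : ∀ i, (ts i).realize (Sum.elim e b) = (ts i).realize (Sum.elim e' b) := fun i =>
      term b _ fun x hx => h x (Set.mem_iUnion.2 ⟨i, hx⟩)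
    simp only [Ref, this]
  | nrel R ts =>
    have : ∀ i, (ts i).realize (Sum.elim e b) = (ts i).realize (Sum.elim e' b) := fun i =>
      term b _ fun x hx => h x (Set.mem_iUnion.2 ⟨i, hx⟩)
    simp only [Ref, this]
  | memX t => simp only [Ref, term b t h]
  | nmemX t => simp only [Ref, term b t h]
  | and φ ψ h1 h2 =>
    exact or_congr (h1 b fun x hx => h x (Or.inl hx)) (h2 b fun x hx => h x (Or.inr hx))
  | or φ ψ h1 h2 =>
    exact and_congr (h1 b fun x hx => h x (Or.inl hx)) (h2 b fun x hx => h x (Or.inr hx))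
  | all φ ih => exact exists_congr fun x => ih _ h
  | ex φ ih => exact forall_congr' fun x => ih _ h

theorem ref_subst {n m : ℕ} (ρ : Finset (ℕ × Bool)) (e : ℕ → ℕ) (b : Fin m → ℕ) (φ : Fml n)
    (σ : ℕ ⊕ Fin n → Tm m) (e' : ℕ → ℕ) (b' : Fin n → ℕ)
    (h : ∀ i, (σ i).realize (Sum.elim e b) = Sum.elim e' b' i) :
    (φ.subst σ).Ref ρ e b ↔ φ.Ref ρ e' b' := by
  have hterm : (fun i => (σ i).realize (Sum.elim e b)) = Sum.elim e' b' := funext h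
  induction φ generalizing m with
  | rel R ts => simp only [subst, Ref, Term.realize_subst, hterm]
  | nrel R ts => simp only [subst, Ref, Term.realize_subst, hterm]
  | memX t => simp only [subst, Ref, Term.realize_subst, hterm]
  | nmemX t => simp only [subst, Ref, Term.realize_subst, hterm]
  | and φ ψ h1 h2 => simp only [subst, Ref, h1 b σ b' h hterm, h2 b σ b' h hterm]
  | or φ ψ h1 h2 => simp only [subst, Ref, h1 b σ b' h hterm, h2 b σ b' h hterm]
  | all φ ih =>
    simp only [subst, Ref]
    exact exists_congr fun x => ih _ _ _ (realize_liftSubst x h) (funext (realize_liftSubst x h))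
  | ex φ ih =>
    simp only [subst, Ref]
    exact forall_congr' fun x => ih _ _ _ (realize_liftSubst x h) (funext (realize_liftSubst x h))

theorem ref_inst (ρ : Finset (ℕ × Bool)) (e : ℕ → ℕ) (φ : Fml 1) (u : Tm 0) :
    (φ.inst u).Ref ρ e Fin.elim0 ↔
      φ.Ref ρ e (Fin.cons (u.realize (Sum.elim e Fin.elim0)) Fin.elim0 : Fin 1 → ℕ) := by
  refine ref_subst _ _ _ _ _ _ _ ?_
  rintro (x | i)
  · rfl
  · have : i = 0 := Subsingleton.elim _ _
    subst this
    rfl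

theorem ref_compl_iff_holds {n : ℕ} (ρ : Finset (ℕ × Bool)) (χ : Set ℕ) (e : ℕ → ℕ)
    (b : Fin n → ℕ) {φ : Fml n} (h : φ.XFree) : φ.compl.Ref ρ e b ↔ φ.Holds χ e b := by
  induction φ with
  | rel R ts => rfl
  | nrel R ts => rfl
  | memX t => exact h.elim
  | nmemX t => exact h.elim
  | and φ ψ h1 h2 => simp only [compl, Ref, Holds, h1 _ h.1, h2 _ h.2]
  | or φ ψ h1 h2 => simp only [compl, Ref, Holds, h1 _ h.1, h2 _ h.2]
  | all φ ih => simp only [compl, Ref, Holds, ih _ h]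
  | ex φ ih => simp only [compl, Ref, Holds, ih _ h]

theorem IsLiteral.not_ref_compl {φ : Fml 0} (h : φ.IsLiteral) {ρ : Finset (ℕ × Bool)}
    (hρ : IsPartialPredicate ρ) {e : ℕ → ℕ} {b : Fin 0 → ℕ} (h1 : φ.Ref ρ e b) :
    ¬ φ.compl.Ref ρ e b := by
  cases φ with
  | rel R ts => exact h1
  | nrel R ts => exact not_not.2 h1
  | memX t => exact fun h2 => hρ _ ⟨h2, h1⟩
  | nmemX t => exact fun h2 => hρ _ ⟨h1, h2⟩
  | _ => exact h.elim

theorem ref_le_lift {n : ℕ} (ρ : Finset (ℕ × Bool)) (e : ℕ → ℕ) (b : Fin n → ℕ) (x : ℕ)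
    (t : Tm n) : (le (Tm.bvar 0) t.lift).Ref ρ e (Fin.cons x b : Fin (n + 1) → ℕ) ↔
      ¬ x ≤ t.realize (Sum.elim e b) := by
  rw [← Tm.realize_lift t e x b]
  rfl

theorem ref_compl_le_lift {n : ℕ} (ρ : Finset (ℕ × Bool)) (e : ℕ → ℕ) (b : Fin n → ℕ) (x : ℕ)
    (t : Tm n) : (le (Tm.bvar 0) t.lift).compl.Ref ρ e (Fin.cons x b : Fin (n + 1) → ℕ) ↔
      x ≤ t.realize (Sum.elim e b) := by
  rw [← Tm.realize_lift t e x b]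
  rfl

/-- A `Δ₀(X)`-formula is decided by every partial predicate whose domain contains a suitable
finite set. -/
theorem IsDelta0.exists_query {n : ℕ} {φ : Fml n} (h : φ.IsDelta0) (e : ℕ → ℕ)
    (b : Fin n → ℕ) : ∃ Q : Finset ℕ, ∀ ρ : Finset (ℕ × Bool),
      (∀ q ∈ Q, ∃ i : Bool, (q, i) ∈ ρ) → φ.Ref ρ e b ∨ φ.compl.Ref ρ e b := by
  induction h with
  | literal φ h =>
    cases φ with
    | rel R ts => exact ⟨∅, fun ρ _ => (Classical.em _).symm⟩
    | nrel R ts => exact ⟨∅, fun ρ _ => Classical.em _⟩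
    | memX t =>
      refine ⟨{t.realize (Sum.elim e b)}, fun ρ hρ => ?_⟩
      obtain ⟨i, hi⟩ := hρ _ (Finset.mem_singleton_self _)
      cases i
      · exact Or.inl hi
      · exact Or.inr hi
    | nmemX t =>
      refine ⟨{t.realize (Sum.elim e b)}, fun ρ hρ => ?_⟩
      obtain ⟨i, hi⟩ := hρ _ (Finset.mem_singleton_self _)
      cases i
      · exact Or.inr hi
      · exact Or.inl hi
    | _ => exact h.elim
  | and φ ψ _ _ h1 h2 =>
    obtain ⟨Q1, h1⟩ := h1 b
    obtain ⟨Q2, h2⟩ := h2 b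
    refine ⟨Q1 ∪ Q2, fun ρ hρ => ?_⟩
    have h1 := h1 ρ fun q hq => hρ q (Finset.mem_union_left _ hq)
    have h2 := h2 ρ fun q hq => hρ q (Finset.mem_union_right _ hq)
    simp only [Ref]; tauto
  | or φ ψ _ _ h1 h2 =>
    obtain ⟨Q1, h1⟩ := h1 b
    obtain ⟨Q2, h2⟩ := h2 b
    refine ⟨Q1 ∪ Q2, fun ρ hρ => ?_⟩
    have h1 := h1 ρ fun q hq => hρ q (Finset.mem_union_left _ hq)
    have h2 := h2 ρ fun q hq => hρ q (Finset.mem_union_right _ hq)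
    simp only [Ref]; tauto
  | ball t φ _ ih =>
    choose Q hQ using fun x : ℕ => ih (Fin.cons x b)
    refine ⟨(Finset.range (t.realize (Sum.elim e b) + 1)).biUnion Q, fun ρ hρ => ?_⟩
    by_cases hx : ∃ x ≤ t.realize (Sum.elim e b), φ.Ref ρ e (Fin.cons x b : Fin (_ + 1) → ℕ)
    · obtain ⟨x, hx, h⟩ := hx
      exact Or.inl ⟨x, (ref_compl_le_lift _ _ _ _ _).2 hx, h⟩
    · refine Or.inr fun x => ?_
      by_cases hxt : x ≤ t.realize (Sum.elim e b)
      · refine Or.inr ((hQ x ρ fun q hq => hρ q ?_).resolve_left fun h => hx ⟨x, hxt, h⟩)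
        exact Finset.mem_biUnion.2 ⟨x, Finset.mem_range.2 (by omega), hq⟩
      · exact Or.inl ((by simpa only [compl_compl] using (ref_le_lift _ _ _ _ _).2 hxt))
  | bex t φ _ ih =>
    choose Q hQ using fun x : ℕ => ih (Fin.cons x b)
    refine ⟨(Finset.range (t.realize (Sum.elim e b) + 1)).biUnion Q, fun ρ hρ => ?_⟩
    by_cases hx : ∃ x ≤ t.realize (Sum.elim e b),
        φ.compl.Ref ρ e (Fin.cons x b : Fin (_ + 1) → ℕ)
    · obtain ⟨x, hx, h⟩ := hx
      exact Or.inr ⟨x, (ref_compl_le_lift _ _ _ _ _).2 hx, h⟩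
    · refine Or.inl fun x => ?_
      by_cases hxt : x ≤ t.realize (Sum.elim e b)
      · refine Or.inr ((hQ x ρ fun q hq => hρ q ?_).resolve_right fun h => hx ⟨x, hxt, h⟩)
        exact Finset.mem_biUnion.2 ⟨x, Finset.mem_range.2 (by omega), hq⟩
      · exact Or.inl ((ref_le_lift _ _ _ _ _).2 hxt)

end Fml

/-! ### Won positions of the game -/

/-- `PW prec h T ρ`: Prover can enforce a win from the position `(T, ρ)`. -/
inductive PW (prec : ℕ → ℕ → Prop) (h : ℕ) : Finset (List ℕ) → Finset (ℕ × Bool) → Prop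
  | mk (T : Finset (List ℕ)) (ρ : Finset (ℕ × Bool)) (Q : Finset ℕ)
      (μ : Finset (ℕ × Bool) → Move) (T' : Finset (ℕ × Bool) → Finset (List ℕ)) :
      (∀ ρ', LegalAnswer prec Q ρ' → IsPartialPredicate (ρ' ∪ ρ) → Next h T (μ ρ') (T' ρ')) →
      (∀ ρ', LegalAnswer prec Q ρ' → IsPartialPredicate (ρ' ∪ ρ) → PW prec h (T' ρ') (ρ' ∪ ρ)) →
      PW prec h T ρ

theorem PW.intro {prec : ℕ → ℕ → Prop} {h : ℕ} {T : Finset (List ℕ)} {ρ : Finset (ℕ × Bool)}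
    (Q : Finset ℕ) (H : ∀ ρ', LegalAnswer prec Q ρ' → IsPartialPredicate (ρ' ∪ ρ) →
      ∃ μ T', Next h T μ T' ∧ PW prec h T' (ρ' ∪ ρ)) : PW prec h T ρ := by
  have H' : ∀ ρ', ∃ μ T', LegalAnswer prec Q ρ' → IsPartialPredicate (ρ' ∪ ρ) →
      Next h T μ T' ∧ PW prec h T' (ρ' ∪ ρ) := by
    intro ρ'
    by_cases h1 : LegalAnswer prec Q ρ' ∧ IsPartialPredicate (ρ' ∪ ρ)
    · obtain ⟨μ, T', h2⟩ := H ρ' h1.1 h1.2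
      exact ⟨μ, T', fun _ _ => h2⟩
    · exact ⟨.extend 0, ∅, fun h2 h3 => absurd ⟨h2, h3⟩ h1⟩
  choose μ T' H' using H'
  exact .mk T ρ Q μ T' (fun ρ' h1 h2 => (H' ρ' h1 h2).1) fun ρ' h1 h2 => (H' ρ' h1 h2).2

/-- A bound by an ordinal on the length of the game from a won position. -/
inductive PWRank (prec : ℕ → ℕ → Prop) (h : ℕ) : Ordinal.{0} → Position → Prop
  | mk (α : Ordinal.{0}) (T : Finset (List ℕ)) (ρ : Finset (ℕ × Bool)) (Q : Finset ℕ)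
      (μ : Finset (ℕ × Bool) → Move) (T' : Finset (ℕ × Bool) → Finset (List ℕ))
      (β : Finset (ℕ × Bool) → Ordinal.{0}) :
      (∀ ρ', LegalAnswer prec Q ρ' → IsPartialPredicate (ρ' ∪ ρ) →
        Next h T (μ ρ') (T' ρ') ∧ β ρ' < α) →
      (∀ ρ', LegalAnswer prec Q ρ' → IsPartialPredicate (ρ' ∪ ρ) →
        PWRank prec h (β ρ') (T' ρ', ρ' ∪ ρ)) →
      PWRank prec h α (T, ρ)

theorem PW.exists_rank {prec : ℕ → ℕ → Prop} {h : ℕ} {T : Finset (List ℕ)}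
    {ρ : Finset (ℕ × Bool)} (hp : PW prec h T ρ) : ∃ α, PWRank prec h α (T, ρ) := by
  induction hp with
  | mk T ρ Q μ T' h1 _ ih =>
    have ih' : ∀ ρ', ∃ β, LegalAnswer prec Q ρ' → IsPartialPredicate (ρ' ∪ ρ) →
        PWRank prec h β (T' ρ', ρ' ∪ ρ) := by
      intro ρ'
      by_cases h3 : LegalAnswer prec Q ρ' ∧ IsPartialPredicate (ρ' ∪ ρ)
      · obtain ⟨β, h4⟩ := ih ρ' h3.1 h3.2
        exact ⟨β, fun _ _ => h4⟩
      · exact ⟨0, fun h4 h5 => absurd ⟨h4, h5⟩ h3⟩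
    choose β hβ using ih'
    exact ⟨_, .mk (⨆ ρ', Order.succ (β ρ')) T ρ Q μ T' β (fun ρ' h3 h4 =>
      ⟨h1 ρ' h3 h4,
        (Order.lt_succ _).trans_le (Ordinal.le_iSup (fun ρ' => Order.succ (β ρ')) ρ')⟩) hβ⟩

/-- If every initial position is won, there is one strategy which wins against all strategies of
Delayer. -/
theorem proverWins_of_forall_pw {prec : ℕ → ℕ → Prop} {h : ℕ}
    (H : ∀ m, PW prec h {[]} {(m, true)}) : ProverWins prec h := by
  classical
  -- Minimality of the rank makes the positional choice of moves progress.
  have hchoice : ∀ P : Position, ∃ (Q : Finset ℕ) (μ : Finset (ℕ × Bool) → Move),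
      ∀ α, PWRank prec h α P → (∀ β < α, ¬ PWRank prec h β P) →
        ∀ ρ', LegalAnswer prec Q ρ' → IsPartialPredicate (ρ' ∪ P.2) →
          ∃ T', Next h P.1 (μ ρ') T' ∧ ∃ β < α, PWRank prec h β (T', ρ' ∪ P.2) := by
    intro P
    by_cases hP : ∃ α, PWRank prec h α P
    · have hmin := WellFounded.min_mem Ordinal.lt_wf {α | PWRank prec h α P} hP
      generalize hγ : WellFounded.min Ordinal.lt_wf {α | PWRank prec h α P} hP = γ at hmin
      have hlt : ∀ β, PWRank prec h β P → γ ≤ β := fun β hβ => by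
        rw [← hγ]; exact not_lt.1 (WellFounded.not_lt_min Ordinal.lt_wf _ hβ)
      have hmin : PWRank prec h γ P := hmin
      cases hmin with
      | mk _ T ρ Q μ T' β h1 h2 =>
        refine ⟨Q, μ, fun α hα hαmin ρ' h3 h4 => ?_⟩
        have : α = γ :=
          le_antisymm (not_lt.1 fun h' => hαmin γ h' (.mk _ T ρ Q μ T' β h1 h2)) (hlt α hα)
        subst this
        exact ⟨T' ρ', (h1 ρ' h3 h4).1, β ρ', (h1 ρ' h3 h4).2, h2 ρ' h3 h4⟩
    · exact ⟨∅, fun _ => .extend 0, fun α hα => absurd ⟨α, hα⟩ hP⟩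
  choose Q μ hQμ using hchoice
  refine ⟨⟨fun play => Q (play.getLastD (∅, ∅)), fun play _ ρ' => μ (play.getLastD (∅, ∅)) ρ'⟩,
    fun g => ?_⟩
  obtain ⟨α, hα⟩ := (H g.start).exists_rank
  suffices ∀ α past P, PWRank prec h α P → WinsFrom h
      ⟨fun play => Q (play.getLastD (∅, ∅)), fun play _ ρ' => μ (play.getLastD (∅, ∅)) ρ'⟩
      g past P from this α _ _ hα
  intro α
  induction α using WellFoundedLT.induction with
  | _ α ih =>
    intro past P hP
    by_cases hmin : ∃ β < α, PWRank prec h β P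
    · obtain ⟨β, hβ, hP'⟩ := hmin
      exact ih β hβ past P hP'
    obtain ⟨T, ρ⟩ := P
    have key := hQμ (T, ρ) α hP (by push Not at hmin; exact hmin)
    have hlegal := g.legal (past ++ [(T, ρ)]) (Q (T, ρ))
    by_cases hpp : IsPartialPredicate (g.answer (past ++ [(T, ρ)]) (Q (T, ρ)) ∪ ρ)
    · obtain ⟨T', hT', β, hβ, hP'⟩ := key _ hlegal hpp
      exact .step past T T' ρ _ (Q (T, ρ)) (by simp) rfl hpp (by simpa using hT')
        (ih β hβ _ _ hP')
    · exact .contradict past T ρ _ (Q (T, ρ)) (by simp) rfl hpp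

/-! ### The trees of the game -/

/-- The vertex `c` is the only one of `T` above `c`, and it is the leftmost leaf of `T`. -/
structure IsFront (T : Finset (List ℕ)) (c : List ℕ) : Prop where
  mem : c ∈ T
  eq_of_prefix : ∀ v ∈ T, c <+: v → v = c
  le : ∀ v ∈ leaves T, c ≤ v

/-- The tree `T` with the new vertices `c * i` for `j ≤ i < m`. -/
def grow (T : Finset (List ℕ)) (c : List ℕ) (j m : ℕ) : Finset (List ℕ) :=
  T ∪ (Finset.Ico j m).image fun i => c ++ [i]

theorem mem_grow {T : Finset (List ℕ)} {c v : List ℕ} {j m : ℕ} :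
    v ∈ grow T c j m ↔ v ∈ T ∨ ∃ i, (j ≤ i ∧ i < m) ∧ c ++ [i] = v := by
  simp [grow]

theorem IsFront.isLeast {T : Finset (List ℕ)} {c : List ℕ} (h : IsFront T c) :
    IsLeast (leaves T) c :=
  ⟨⟨h.mem, fun k hk => by simpa using h.eq_of_prefix _ hk (List.prefix_append _ _)⟩, h.le⟩

theorem isFront_root : IsFront {[]} [] := by
  refine ⟨by simp, by simp, fun v hv => ?_⟩
  obtain rfl : v = [] := by simpa using hv.1
  exact le_rfl

theorem append_lt_of_lt_of_not_prefix {c v : List ℕ} (h : c < v) (hp : ¬ c <+: v)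
    (x : List ℕ) : c ++ x < v := by
  induction h with
  | nil => exact absurd List.nil_prefix hp
  | cons _ ih => exact .cons (ih fun h' => hp ((List.prefix_cons_inj _).2 h'))
  | rel h' => exact .rel h'

theorem IsFront.grow {T : Finset (List ℕ)} {c : List ℕ} (h : IsFront T c) {j m : ℕ}
    (hj : j < m) : IsFront (grow T c j m) (c ++ [j]) := by
  refine ⟨mem_grow.2 (Or.inr ⟨j, ⟨le_rfl, hj⟩, rfl⟩), fun v hv hp => ?_, fun v hv => ?_⟩
  · rcases mem_grow.1 hv with hv | ⟨i, -, rfl⟩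
    · have := h.eq_of_prefix v hv ((List.prefix_append _ _).trans hp)
      subst this
      simpa using hp.length_le
    · rw [List.prefix_append_right_inj] at hp
      have : j = i := by simpa using hp.eq_of_length rfl
      rw [this]
  · rcases mem_grow.1 hv.1 with hvT | ⟨i, hi, rfl⟩
    · have hvc : v ≠ c := by
        rintro rfl
        exact hv.2 j (mem_grow.2 (Or.inr ⟨j, ⟨le_rfl, hj⟩, rfl⟩))
      have hle := h.le v ⟨hvT, fun k hk => hv.2 k (mem_grow.2 (Or.inl hk))⟩
      exact (append_lt_of_lt_of_not_prefix (lt_of_le_of_ne hle hvc.symm)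
        (fun hp => hvc (h.eq_of_prefix v hvT hp)) _).le
    · rcases hi.1.eq_or_lt with rfl | hlt
      · exact le_rfl
      · refine le_of_lt ?_
        clear hv h
        induction c with
        | nil => exact .rel hlt
        | cons a c ih => exact .cons ih

theorem IsFront.filter_grow {T : Finset (List ℕ)} {c : List ℕ} (h : IsFront T c) {j m : ℕ} :
    ((TIGame.grow T c j m).filter fun v => ¬ (c ++ [j]) <+: v) = TIGame.grow T c (j + 1) m := by
  ext v
  simp only [Finset.mem_filter, mem_grow]
  constructor
  · rintro ⟨hv | ⟨i, hi, rfl⟩, hp⟩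
    · exact Or.inl hv
    · refine Or.inr ⟨i, ⟨?_, hi.2⟩, rfl⟩
      rcases hi.1.eq_or_lt with rfl | hlt
      · exact absurd (List.prefix_refl _) hp
      · exact hlt
  · rintro (hv | ⟨i, hi, rfl⟩)
    · refine ⟨Or.inl hv, fun hp => ?_⟩
      have := h.eq_of_prefix v hv ((List.prefix_append _ _).trans hp)
      subst this
      simpa using hp.length_le
    · refine ⟨Or.inr ⟨i, ⟨by omega, hi.2⟩, rfl⟩, fun hp => ?_⟩
      rw [List.prefix_append_right_inj] at hp
      have : j = i := by simpa using hp.eq_of_length rfl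
      omega

theorem filter_grow_of_prefix {T : Finset (List ℕ)} {c p : List ℕ} (hp : p <+: c) {j m : ℕ} :
    ((grow T c j m).filter fun v => ¬ p <+: v) = T.filter fun v => ¬ p <+: v := by
  ext v
  simp only [Finset.mem_filter, mem_grow]
  constructor
  · rintro ⟨hv | ⟨i, hi, rfl⟩, h⟩
    · exact ⟨hv, h⟩
    · exact absurd (hp.trans (List.prefix_append _ _)) h
  · exact fun ⟨hv, h⟩ => ⟨Or.inl hv, h⟩

theorem treeHeight_grow_le {T : Finset (List ℕ)} {c : List ℕ} {j m h : ℕ}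
    (hT : treeHeight T ≤ h) (hc : c.length + 1 ≤ h) : treeHeight (grow T c j m) ≤ h := by
  refine Finset.sup_le fun v hv => ?_
  rcases mem_grow.1 hv with hv | ⟨i, -, rfl⟩
  · exact (Finset.le_sup (f := List.length) hv).trans hT
  · simpa using hc

theorem IsFront.next_extend {T : Finset (List ℕ)} {c : List ℕ} {h : ℕ} (hc : IsFront T c)
    (hT : treeHeight T ≤ h) (hh : c.length + 1 ≤ h) (b : ℕ) :
    Next h T (.extend b) (TIGame.grow T c 0 (b + 1)) := by
  have := treeHeight_grow_le (j := 0) (m := b + 1) hT hh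
  simp only [TIGame.grow, ← Finset.range_eq_Ico] at this ⊢
  exact .extend c b hc.isLeast this

theorem PW.of_extend {prec : ℕ → ℕ → Prop} {h : ℕ} {T : Finset (List ℕ)} {c : List ℕ}
    {ρ : Finset (ℕ × Bool)} (hc : IsFront T c) (hT : treeHeight T ≤ h)
    (hh : c.length + 1 ≤ h) (Q : Finset ℕ) (b : ℕ)
    (H : ∀ ρ', LegalAnswer prec Q ρ' → IsPartialPredicate (ρ' ∪ ρ) →
      PW prec h (grow T c 0 (b + 1)) (ρ' ∪ ρ)) : PW prec h T ρ :=
  .intro Q fun ρ' h1 h2 => ⟨_, _, hc.next_extend hT hh b, H ρ' h1 h2⟩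

/-! ### The strategy read off from a derivation -/

/-- The second member of `TI(≺)` without its outer quantifier. -/
def progress (prec : ℕ → ℕ → Prop) : Fml 1 :=
  Fml.all (Fml.and (Fml.memX (Tm.bvar 1))
    (Fml.or (Fml.nmemX (Tm.bvar 0)) (Fml.lt prec (Tm.bvar 0) (Tm.bvar 1)).compl))

theorem ref_progress {prec : ℕ → ℕ → Prop} {ρ : Finset (ℕ × Bool)} {e : ℕ → ℕ} {q : ℕ}
    (h : (q, false) ∈ ρ ∨ ∃ p, (p, true) ∈ ρ ∧ prec p q) :
    (progress prec).Ref ρ e (Fin.cons q Fin.elim0 : Fin 1 → ℕ) := by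
  rcases h with h | ⟨p, h1, h2⟩
  · exact ⟨0, Or.inl h⟩
  · exact ⟨p, Or.inr ⟨h1, h2⟩⟩

/-- Some ancestor of the current leaf `c` has a sibling next to it on the right, from which Prover
wins as soon as the recorded partial predicate refutes the complement of `φ`. -/
def HasReturn (prec : ℕ → ℕ → Prop) (h : ℕ) (T : Finset (List ℕ)) (c : List ℕ)
    (ρ : Finset (ℕ × Bool)) (e : ℕ → ℕ) (φ : Fml 0) : Prop :=
  ∃ b k σ, c = b ++ [k] ++ σ ∧ b ++ [k + 1] ∈ T ∧
    ∀ ρ', ρ ⊆ ρ' → IsPartialPredicate ρ' → φ.compl.Ref ρ' e Fin.elim0 →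
      PW prec h (T.filter fun v => ¬ (b ++ [k]) <+: v) ρ'

/-- What Prover maintains about the formulas of the sequent at the current leaf: each is refuted,
or the progress formula, or a `pΣ₁(X)`-formula a witness of which allows to go back. -/
def Good (prec : ℕ → ℕ → Prop) (h : ℕ) (T : Finset (List ℕ)) (c : List ℕ)
    (ρ : Finset (ℕ × Bool)) (e : ℕ → ℕ) (φ : Fml 0) : Prop :=
  φ.Ref ρ e Fin.elim0 ∨ φ = Fml.ex (progress prec) ∨
    (φ.IsPSigma 1 ∧ HasReturn prec h T c ρ e φ)

theorem Good.grow {prec : ℕ → ℕ → Prop} {h : ℕ} {T : Finset (List ℕ)} {c : List ℕ}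
    {ρ ρ' : Finset (ℕ × Bool)} {e e' : ℕ → ℕ} {φ : Fml 0} (hφ : Good prec h T c ρ e φ)
    (hρ : ρ ⊆ ρ') (he : ∀ x ∈ φ.fv, e x = e' x) (j m : ℕ) :
    Good prec h (TIGame.grow T c j m) (c ++ [j]) ρ' e' φ := by
  rcases hφ with hφ | hφ | ⟨hφ, b, k, σ, rfl, hb, H⟩
  · exact Or.inl ((Fml.ref_congr _ _ _ he).1 (hφ.mono hρ))
  · exact Or.inr (Or.inl hφ)
  · refine Or.inr (Or.inr ⟨hφ, b, k, σ ++ [j], by simp, mem_grow.2 (Or.inl hb), ?_⟩)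
    intro ρ'' h1 h2 h3
    rw [filter_grow_of_prefix (List.prefix_append _ _)]
    exact H ρ'' (hρ.trans h1) h2 ((Fml.ref_congr _ _ _ (by simpa using he)).2 h3)

theorem Good.ref {prec : ℕ → ℕ → Prop} {h : ℕ} {T : Finset (List ℕ)} {c : List ℕ}
    {ρ : Finset (ℕ × Bool)} {e : ℕ → ℕ} {φ : Fml 0} (hφ : Good prec h T c ρ e φ)
    (hne : ∀ ψ, φ ≠ Fml.ex ψ) : φ.Ref ρ e Fin.elim0 := by
  rcases hφ with hφ | hφ | ⟨hφ, -⟩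
  · exact hφ
  · exact absurd hφ (hne _)
  · obtain ⟨θ, -, hθ, -⟩ := (Fml.isPSigma_one_iff φ).1 hφ
    exact absurd hθ (hne θ)

theorem ref_compl_of_mem_ThN {φ : Fml 0} (h : φ ∈ ThN) (ρ : Finset (ℕ × Bool)) (e : ℕ → ℕ) :
    φ.compl.Ref ρ e Fin.elim0 := by
  obtain ⟨h1, h2, -, h4⟩ := h
  rw [Fml.ref_congr (e' := fun _ => 0) ρ _ _ (by simp [h1])]
  exact (Fml.ref_compl_iff_holds ρ ∅ _ _ h2).2 h4

theorem fv_subset_fv_inst (φ : Fml 1) (u : Tm 0) : φ.fv ⊆ (φ.inst u).fv := fun x hx =>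
  (Fml.mem_fv_subst _ _ _).2 ⟨Sum.inl x, (Fml.mem_fv_iff _ _).1 hx, by simp⟩

/-- Prover wins from every position whose leaf is matched with a derivable sequent of good
formulas, if the height of the derivation fits into the remaining room. Only the rules for cut and
induction create branching: the premises are tried from left to right, and a premise is left for
the next one when a witness of its `pΣ₁(X)`-formula has been found. -/
theorem pw_of_deriv {prec : ℕ → ℕ → Prop} {h : ℕ} (n : ℕ) :
    ∀ (Γ : Sequent) (T : Finset (List ℕ)) (c : List ℕ) (ρ : Finset (ℕ × Bool)) (e : ℕ → ℕ),
      Deriv n Γ → IsFront T c → c.length + n ≤ h → treeHeight T ≤ h → IsPartialPredicate ρ →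
      (∀ φ ∈ Γ, Good prec h T c ρ e φ) → PW prec h T ρ := by
  have hinit : ∀ (Γ : Sequent) (T : Finset (List ℕ)) (c : List ℕ) (ρ : Finset (ℕ × Bool))
      (e : ℕ → ℕ) (L : Fml 0), L.IsLiteral → L ∈ Γ → L.compl ∈ Γ → IsPartialPredicate ρ →
      (∀ φ ∈ Γ, Good prec h T c ρ e φ) → PW prec h T ρ := by
    intro Γ T c ρ e L hL h1 h2 hρ hΓ
    have h1 := (hΓ _ h1).ref (by rintro ψ rfl; exact hL)
    have h2 := (hΓ _ h2).ref (by rintro ψ hψ; cases L <;> simp_all [Fml.IsLiteral, Fml.compl])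
    exact absurd h2 (hL.not_ref_compl hρ h1)
  induction n with
  | zero =>
    intro Γ T c ρ e hD hc hh hT hρ hΓ
    cases hD with
    | initial _ L hL h1 h2 => exact hinit Γ T c ρ e L hL h1 h2 hρ hΓ
  | succ n ih =>
    intro Γ T c ρ e ⟨ps, hrule, hps⟩ hc hh hT hρ hΓ
    have hh1 : c.length + 1 ≤ h := by omega
    have child : ∀ (p : Sequent) (j m : ℕ) (ρ' : Finset (ℕ × Bool)) (e' : ℕ → ℕ), p ∈ ps →
        j < m → IsPartialPredicate ρ' →
        (∀ φ ∈ p, Good prec h (grow T c j m) (c ++ [j]) ρ' e' φ) →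
        PW prec h (grow T c j m) ρ' := fun p j m ρ' e' hp hj hρ' H =>
      ih p _ (c ++ [j]) ρ' e' (hps p hp) (hc.grow hj)
        (by simp only [List.length_append, List.length_singleton]; omega)
        (treeHeight_grow_le hT hh1) hρ' H
    have keep : ∀ {ρ' : Finset (ℕ × Bool)} (j m : ℕ), ρ ⊆ ρ' → ∀ φ ∈ Γ,
        Good prec h (grow T c j m) (c ++ [j]) ρ' e φ := fun j m hρ' φ hφ =>
      (hΓ φ hφ).grow hρ' (fun _ _ => rfl) j m
    have keep_update : ∀ {ρ' : Finset (ℕ × Bool)} (j m a x : ℕ), a ∉ Sequent.fv Γ → ρ ⊆ ρ' →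
        ∀ φ ∈ Γ, Good prec h (grow T c j m) (c ++ [j]) ρ' (Function.update e a x) φ := by
      intro ρ' j m a x ha hρ' φ hφ
      refine (hΓ φ hφ).grow hρ' (fun y hy => ?_) j m
      rw [Function.update_of_ne]
      rintro rfl
      exact ha (Sequent.mem_fv.2 ⟨φ, hφ, hy⟩)
    have hsub : ∀ ρ' : Finset (ℕ × Bool), ρ ⊆ ρ' ∪ ρ := fun _ => Finset.subset_union_right
    cases hrule with
    | initial _ L hL h1 h2 => exact hinit Γ T c ρ e L hL h1 h2 hρ hΓ
    | orLeft _ φ ψ hmem _ =>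
      have hr := (hΓ _ hmem).ref (by simp)
      refine .of_extend hc hT hh1 ∅ 0 fun ρ' _ hpp => child _ 0 1 _ e (List.mem_cons_self ..) one_pos hpp ?_
      exact Finset.forall_mem_insert _ _ _ |>.2 ⟨Or.inl (hr.1.mono (hsub _)), keep _ _ (hsub _)⟩
    | orRight _ φ ψ hmem _ =>
      have hr := (hΓ _ hmem).ref (by simp)
      refine .of_extend hc hT hh1 ∅ 0 fun ρ' _ hpp => child _ 0 1 _ e (List.mem_cons_self ..) one_pos hpp ?_
      exact Finset.forall_mem_insert _ _ _ |>.2 ⟨Or.inl (hr.2.mono (hsub _)), keep _ _ (hsub _)⟩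
    | and _ φ ψ hmem _ _ =>
      refine .of_extend hc hT hh1 ∅ 0 fun ρ' _ hpp => ?_
      rcases (hΓ _ hmem).ref (by simp) with hr | hr
      · refine child (insert φ Γ) 0 1 _ e (by simp) one_pos hpp ?_
        exact Finset.forall_mem_insert _ _ _ |>.2 ⟨Or.inl (hr.mono (hsub _)), keep _ _ (hsub _)⟩
      · refine child (insert ψ Γ) 0 1 _ e (by simp) one_pos hpp ?_
        exact Finset.forall_mem_insert _ _ _ |>.2 ⟨Or.inl (hr.mono (hsub _)), keep _ _ (hsub _)⟩
    | all _ φ a hmem ha _ =>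
      obtain ⟨x, hx⟩ := (hΓ _ hmem).ref (by simp)
      refine .of_extend hc hT hh1 ∅ 0 fun ρ' _ hpp =>
        child _ 0 1 _ (Function.update e a x) (List.mem_cons_self ..) one_pos hpp ?_
      refine Finset.forall_mem_insert _ _ _ |>.2
        ⟨Or.inl ?_, keep_update _ _ _ _ ha (hsub _)⟩
      rw [Fml.ref_inst, Tm.realize_fvar, Sum.elim_inl, Function.update_self]
      refine (Fml.ref_congr _ _ _ fun y hy => ?_).1 (hx.mono (hsub _))
      rw [Function.update_of_ne]
      rintro rfl
      exact ha (Sequent.mem_fv.2 ⟨_, hmem, hy⟩)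
    | trueSentence _ φ hφ _ =>
      refine .of_extend hc hT hh1 ∅ 0 fun ρ' _ hpp => child _ 0 1 _ e (List.mem_cons_self ..) one_pos hpp ?_
      exact Finset.forall_mem_insert _ _ _ |>.2
        ⟨Or.inl (ref_compl_of_mem_ThN hφ _ _), keep _ _ (hsub _)⟩
    | ex _ φ u hmem _ _ =>
      have close : ∀ ρ', IsPartialPredicate (ρ' ∪ ρ) →
          φ.Ref (ρ' ∪ ρ) e (Fin.cons (u.realize (Sum.elim e Fin.elim0)) Fin.elim0 : Fin 1 → ℕ) →
          PW prec h (grow T c 0 1) (ρ' ∪ ρ) := fun ρ' hpp hr =>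
        child _ 0 1 _ e (List.mem_cons_self ..) one_pos hpp (Finset.forall_mem_insert _ _ _ |>.2
          ⟨Or.inl ((Fml.ref_inst _ _ _ _).2 hr), keep _ _ (hsub _)⟩)
      rcases hΓ _ hmem with hr | hr | ⟨hφ, b, k, σ, hcb, hbT, H⟩
      · exact .of_extend hc hT hh1 ∅ 0 fun ρ' _ hpp => close ρ' hpp (hr.mono (hsub _) _)
      · cases hr
        -- Delayer either denies that `u` is in `X` or names a smaller member of `X`.
        refine .of_extend hc hT hh1 {u.realize (Sum.elim e Fin.elim0)} 0 fun ρ' hl hpp =>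
          close ρ' hpp (ref_progress ?_)
        obtain ⟨i, hi⟩ := hl.2.1 _ (Finset.mem_singleton_self _)
        cases i
        · exact Or.inl (Finset.mem_union_left _ hi)
        · obtain ⟨p, h1, h2⟩ := hl.2.2 _ (Finset.mem_singleton_self _) hi
          exact Or.inr ⟨p, Finset.mem_union_left _ h1, h2⟩
      · obtain ⟨θ, hθ, hφθ, -⟩ := (Fml.isPSigma_one_iff _).1 hφ
        cases hφθ
        obtain ⟨Q, hQ⟩ := hθ.exists_query e (Fin.cons (u.realize (Sum.elim e Fin.elim0)) Fin.elim0)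
        refine .intro Q fun ρ' hl hpp => ?_
        rcases hQ (ρ' ∪ ρ) fun q hq =>
          (hl.2.1 q hq).imp fun i hi => Finset.mem_union_left _ hi with hr | hr
        · exact ⟨_, _, hc.next_extend hT hh1 0, close ρ' hpp hr⟩
        · exact ⟨_, _, .back c b k σ hc.isLeast hcb hbT, H _ (hsub _) hpp ⟨_, hr⟩⟩
    | cut _ φ hφ _ _ _ _ =>
      refine .of_extend hc hT hh1 ∅ 1 fun ρ' _ hpp =>
        child (insert φ Γ) 0 2 _ e (by simp) two_pos hpp ?_
      refine Finset.forall_mem_insert _ _ _ |>.2 ⟨Or.inr (Or.inr ⟨hφ, c, 0, [], by simp,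
        mem_grow.2 (Or.inr ⟨1, by simp, rfl⟩), fun ρ'' h1 hpp' hr => ?_⟩), keep _ _ (hsub _)⟩
      rw [hc.filter_grow]
      refine child (insert φ.compl Γ) 1 2 _ e (by simp) one_lt_two hpp' ?_
      exact Finset.forall_mem_insert _ _ _ |>.2
        ⟨Or.inl hr, keep _ _ ((hsub _).trans h1)⟩
    | induction _ φ a t hφ _ _ _ ha hfv0 _ _ =>
      have haφ : a ∉ φ.fv := fun h' => ha <| by
        rw [← hfv0, Sequent.fv_insert]
        exact Or.inl (fv_subset_fv_inst _ _ h')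
      have upd : ∀ (ρ' : Finset (ℕ × Bool)) (x : ℕ) (b : Fin 1 → ℕ),
          φ.compl.Ref ρ' e b ↔ φ.compl.Ref ρ' (Function.update e a x) b := by
        refine fun ρ' x b => Fml.ref_congr _ _ _ fun y hy => ?_
        rw [Function.update_of_ne]
        rintro rfl
        exact haφ (by simpa using hy)
      set N := t.realize (Sum.elim e Fin.elim0) with hN
      -- The child `j + 1 ≤ N` stands for the second premise with the value `j` of `a`.
      have main : ∀ d j, j + d = N + 1 → ∀ ρ', ρ ⊆ ρ' → IsPartialPredicate ρ' →
          (∀ i, j = i + 1 → φ.compl.Ref ρ' e (Fin.cons i Fin.elim0 : Fin 1 → ℕ)) →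
          PW prec h (grow T c j (N + 2)) ρ' := by
        intro d
        induction d with
        | zero =>
          intro j hj ρ' hρ' hpp hr
          refine child (insert (φ.inst t).compl Γ) j _ _ e (by simp) (by omega) hpp ?_
          refine Finset.forall_mem_insert _ _ _ |>.2 ⟨Or.inl ?_, keep _ _ hρ'⟩
          rw [Fml.inst_compl, Fml.ref_inst]
          exact hr N hj
        | succ d ihd =>
          intro j hj ρ' hρ' hpp hr
          have hnext : c ++ [j + 1] ∈ grow T c j (N + 2) :=
            mem_grow.2 (Or.inr ⟨j + 1, by omega, rfl⟩)
          rcases j with _ | i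
          · refine child (insert (φ.inst (Tm.const 0)) Γ) 0 _ _ e (by simp) (by omega) hpp ?_
            refine Finset.forall_mem_insert _ _ _ |>.2 ⟨Or.inr (Or.inr ⟨hφ.subst _, c, 0, [],
              by simp, hnext, fun ρ'' h1 hpp' hr' => ?_⟩), keep _ _ hρ'⟩
            rw [hc.filter_grow]
            refine ihd 1 (by omega) ρ'' (hρ'.trans h1) hpp' fun i hi => ?_
            obtain rfl : i = 0 := by omega
            rwa [Fml.inst_compl, Fml.ref_inst] at hr'
          · refine child (insert (φ.inst (Tm.fvar a)).compl
              (insert (φ.inst (Tm.fvar a).succ) Γ)) (i + 1) _ _ (Function.update e a i)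
              (by simp) (by omega) hpp ?_
            refine Finset.forall_mem_insert _ _ _ |>.2 ⟨Or.inl ?_,
              Finset.forall_mem_insert _ _ _ |>.2 ⟨Or.inr (Or.inr ⟨hφ.subst _, c, i + 1, [],
              by simp, hnext, fun ρ'' h1 hpp' hr' => ?_⟩), keep_update _ _ _ _ ha hρ'⟩⟩
            · rw [Fml.inst_compl, Fml.ref_inst, Tm.realize_fvar, Sum.elim_inl,
                Function.update_self, ← upd]
              exact hr i rfl
            · rw [hc.filter_grow]
              refine ihd (i + 1 + 1) (by omega) ρ'' (hρ'.trans h1) hpp' fun i' hi' => ?_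
              obtain rfl : i' = i + 1 := by omega
              rwa [Fml.inst_compl, Fml.ref_inst, Tm.realize_succ, Tm.realize_fvar, Sum.elim_inl,
                Function.update_self, ← upd] at hr'
      exact .of_extend hc hT hh1 ∅ (N + 1) fun ρ' _ hpp =>
        main (N + 1) 0 (by omega) _ (hsub _) hpp (by simp)

theorem proverWins_of_deriv {prec : ℕ → ℕ → Prop} {h : ℕ} (hD : Deriv h (TI prec)) :
    ProverWins prec h := by
  refine proverWins_of_forall_pw fun m => ?_
  refine pw_of_deriv h (TI prec) {[]} [] {(m, true)} (fun _ => 0) hD isFront_root (by simp)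
    (by simp [treeHeight]) (fun x => by simp) ?_
  intro φ hφ
  rcases Finset.mem_insert.1 hφ with rfl | hφ
  · exact Or.inl ⟨m, by simp [Fml.Ref]⟩
  · exact Or.inr (Or.inl (Finset.mem_singleton.1 hφ))

/-! ### Derivability -/

/-- The sequent has an `IΣ₁(X)`-derivation. -/
def Derivable (Γ : Sequent) : Prop := ∃ n, Deriv n Γ

theorem Derivable.of_rule {ps : List Sequent} {Γ : Sequent} (h : Rule 1 ps Γ)
    (hps : ∀ p ∈ ps, Derivable p) : Derivable Γ := by
  have : ∃ n, ∀ p ∈ ps, Deriv n p := by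
    clear h
    induction ps with
    | nil => exact ⟨0, by simp⟩
    | cons p ps ih =>
      obtain ⟨n, hn⟩ := ih fun q hq => hps q (List.mem_cons_of_mem _ hq)
      obtain ⟨m, hm⟩ := hps p List.mem_cons_self
      refine ⟨max m n, fun q hq => ?_⟩
      rcases List.mem_cons.1 hq with rfl | hq
      · exact hm.mono (le_max_left _ _)
      · exact (hn q hq).mono (le_max_right _ _)
  obtain ⟨n, hn⟩ := this
  exact ⟨n + 1, ps, h, hn⟩

/-- Derivations of the premises of a rule are put side by side above a new root. -/
theorem exists_isDerivation_of_rule {ps : List Sequent} {Γ : Sequent} (h : Rule 1 ps Γ)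
    (hps : ∀ p ∈ ps, ∃ τ lab, IsDerivation 1 τ lab p) : ∃ τ lab, IsDerivation 1 τ lab Γ := by
  choose τ lab hD using fun i : Fin ps.length => hps ps[i] (List.getElem_mem i.2)
  let T : Finset (List ℕ) :=
    insert [] (Finset.univ.biUnion fun i : Fin ps.length => (τ i).image fun v => i.val :: v)
  let L : List ℕ → Sequent := fun v => match v with
    | [] => Γ
    | k :: v => if hk : k < ps.length then lab ⟨k, hk⟩ v else ∅
  have hroot : ∀ i, [] ∈ τ i := fun i => by
    obtain ⟨w, hw⟩ := (hD i).1.1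
    exact (hD i).1.2 _ _ List.nil_prefix hw
  have hmem : ∀ k v, k :: v ∈ T ↔ ∃ hk : k < ps.length, v ∈ τ ⟨k, hk⟩ := by
    intro k v
    simp only [T, Finset.mem_insert, Finset.mem_biUnion, Finset.mem_image, Finset.mem_univ,
      true_and, reduceCtorEq, false_or]
    constructor
    · rintro ⟨i, w, hw, he⟩
      cases he
      exact ⟨i.2, hw⟩
    · rintro ⟨hk, hv⟩
      exact ⟨⟨k, hk⟩, v, hv, rfl⟩
  have hL : ∀ k (hk : k < ps.length) v, L (k :: v) = lab ⟨k, hk⟩ v := fun k hk v => dif_pos hk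
  refine ⟨T, L, ⟨⟨[], by simp [T]⟩, ?_⟩, rfl, ?_⟩
  · intro σ υ hσ hυ
    cases σ with
    | nil => simp [T]
    | cons k σ =>
      obtain ⟨r, rfl⟩ := hσ
      obtain ⟨hk, hv⟩ := (hmem _ _).1 hυ
      exact (hmem _ _).2 ⟨hk, (hD _).1.2 _ _ (List.prefix_append _ _) hv⟩
  · intro v hv
    cases v with
    | nil =>
      refine ⟨List.range ps.length, List.pairwise_lt_range, fun j => ?_, ?_⟩
      · rw [List.mem_range, List.nil_append, hmem]
        exact ⟨fun hj => ⟨hj, hroot _⟩, fun ⟨hj, _⟩ => hj⟩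
      · convert h using 1
        refine List.ext_getElem (by simp) fun i h1 h2 => ?_
        simp only [List.getElem_map, List.getElem_range, List.nil_append, hL i h2]
        exact (hD ⟨i, h2⟩).2.1
    | cons k v =>
      obtain ⟨hk, hv⟩ := (hmem _ _).1 hv
      obtain ⟨ks, h1, h2, h3⟩ := (hD ⟨k, hk⟩).2.2 v hv
      refine ⟨ks, h1, fun j => ?_, ?_⟩
      · rw [h2, List.cons_append, hmem]
        exact ⟨fun hj => ⟨hk, hj⟩, fun ⟨_, hj⟩ => hj⟩
      · simpa only [List.cons_append, hL k hk] using h3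

theorem Derivable.exists_isDerivation {Γ : Sequent} (h : Derivable Γ) :
    ∃ τ lab, IsDerivation 1 τ lab Γ := by
  obtain ⟨n, h⟩ := h
  induction n generalizing Γ with
  | zero => exact exists_isDerivation_of_rule h (by simp)
  | succ n ih =>
    obtain ⟨ps, h, hps⟩ := h
    exact exists_isDerivation_of_rule h fun p hp => ih (hps p hp)

/-! ### Derivability of all instances -/

/-- The substitution of formulas without bound variables which is given by `σ` on free ones. -/
def ofFree (σ : ℕ → Tm 0) : ℕ ⊕ Fin 0 → Tm 0 := Sum.elim σ Fin.elim0

/-- The substitution `σ` extended by the value `u` of a new bound variable. -/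
def consSubst {n : ℕ} (u : Tm 0) (σ : ℕ ⊕ Fin n → Tm 0) : ℕ ⊕ Fin (n + 1) → Tm 0 :=
  Sum.elim (fun x => σ (Sum.inl x)) (Fin.cons u fun i => σ (Sum.inr i) : Fin (n + 1) → Tm 0)

@[simp] theorem lift_subst_consSubst {n : ℕ} (t : Tm n) (u : Tm 0) (σ : ℕ ⊕ Fin n → Tm 0) :
    t.lift.subst (consSubst u σ) = t.subst σ := by
  rw [Tm.lift_subst]
  congr 1
  funext i
  rcases i with x | i <;> rfl

theorem consSubst_ofFree (u : Tm 0) (σ : ℕ → Tm 0) :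
    consSubst u (ofFree σ) = Sum.elim σ fun _ => u := by
  funext i
  rcases i with x | i
  · rfl
  · obtain rfl : i = 0 := Fin.fin_one_eq_zero i
    rfl

theorem Fml.subst_liftSubst_inst {n : ℕ} (φ : Fml (n + 1)) (σ : ℕ ⊕ Fin n → Tm 0)
    (u : Tm 0) : inst (φ.subst (liftSubst σ)) u = φ.subst (consSubst u σ) := by
  have hv : (Sum.elim Tm.fvar fun _ => u : ℕ ⊕ Fin 1 → Tm 0) = consSubst u (ofFree Tm.fvar) :=
    (consSubst_ofFree u _).symm
  have hid : (ofFree Tm.fvar : ℕ ⊕ Fin 0 → Tm 0) = Term.var := by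
    funext i
    rcases i with x | i
    · rfl
    · exact i.elim0
  rw [inst, hv, hid, subst_subst]
  congr 1
  funext i
  rcases i with x | i
  · exact (lift_subst_consSubst _ _ _).trans (term_subst_var _)
  · induction i using Fin.cases with
    | zero => rfl
    | succ i => exact (lift_subst_consSubst _ _ _).trans (term_subst_var _)

theorem Fml.inst_subst_ofFree (φ : Fml 1) (u : Tm 0) (σ : ℕ → Tm 0) :
    (φ.inst u).subst (ofFree σ) =
      (φ.subst (liftSubst (ofFree σ))).inst (u.subst (ofFree σ)) := by
  rw [subst_liftSubst_inst φ, inst_subst, consSubst_ofFree]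
  rfl

theorem Fml.subst_ofFree_congr (φ : Fml 0) {σ τ : ℕ → Tm 0} (h : ∀ x ∈ φ.fv, σ x = τ x) :
    φ.subst (ofFree σ) = φ.subst (ofFree τ) := by
  refine subst_congr φ ?_
  rintro (x | i) hi
  · exact h x ((mem_fv_iff _ _).2 hi)
  · exact i.elim0

theorem Fml.subst_ofFree_fvar (φ : Fml 0) : φ.subst (ofFree Tm.fvar) = φ := by
  conv_rhs => rw [← subst_var φ]
  congr 1
  funext i
  rcases i with x | i
  · rfl
  · exact i.elim0

theorem Fml.subst_ofFree_of_fv_eq_empty {φ : Fml 0} (h : φ.fv = ∅) (σ : ℕ → Tm 0) :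
    φ.subst (ofFree σ) = φ :=
  (subst_ofFree_congr φ (by simp [h])).trans φ.subst_ofFree_fvar

theorem fvar_subst_update (σ : ℕ → Tm 0) (a : ℕ) (v : Tm 0) :
    (Tm.fvar a : Tm 0).subst (ofFree (Function.update σ a v)) = v := by
  change Function.update σ a v a = v
  rw [Function.update_self]

theorem Fml.inst_subst_update (φ : Fml 1) (u v : Tm 0) (σ : ℕ → Tm 0) {a : ℕ} (ha : a ∉ φ.fv) :
    (φ.inst u).subst (ofFree (Function.update σ a v)) =
      (φ.subst (liftSubst (ofFree σ))).inst (u.subst (ofFree (Function.update σ a v))) := by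
  rw [inst_subst_ofFree, subst_liftSubst_inst φ,
    subst_liftSubst_inst φ, consSubst_ofFree, consSubst_ofFree]
  refine subst_congr φ ?_
  rintro (x | i) hi
  · refine Function.update_of_ne ?_ _ _
    rintro rfl
    exact ha ((mem_fv_iff _ _).2 hi)
  · rfl

theorem Fml.inst_eq_of_notMem_vars {φ : Fml 1} (h : Sum.inr 0 ∉ φ.vars)
    (u v : Tm 0) : φ.inst u = φ.inst v := by
  refine Fml.subst_congr φ ?_
  rintro (x | i) hi
  · rfl
  · obtain rfl : i = 0 := Subsingleton.elim _ _
    exact absurd hi h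

theorem Fml.fv_subset_fv_inst_of_mem_vars {φ : Fml 1} (h : Sum.inr 0 ∈ φ.vars)
    (u : Tm 0) : u.fv ⊆ (φ.inst u).fv :=
  fun _ hx => (Fml.mem_fv_subst _ _ _).2 ⟨Sum.inr 0, h, hx⟩

theorem Fml.fv_inst_subset (φ : Fml 1) (u : Tm 0) :
    (φ.inst u).fv ⊆ φ.fv ∪ u.fv := by
  intro x hx
  obtain ⟨y | i, hi, h⟩ := (Fml.mem_fv_subst _ _ _).1 hx
  · simp only [Sum.elim_inl, Tm.fv_fvar, Set.mem_singleton_iff] at h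
    subst h
    exact Or.inl ((Fml.mem_fv_iff _ _).2 hi)
  · exact Or.inr h

/-- All instances of `Γ`, and all weakenings of them, are derivable, as long as the terms
substituted have no variables which are not free in the conclusion. -/
def Pr (Γ : Sequent) : Prop :=
  ∀ (σ : ℕ → Tm 0) (Δ : Sequent), (∀ x, (σ x).fv ⊆ Sequent.fv Δ) →
    (∀ φ ∈ Γ, φ.subst (ofFree σ) ∈ Δ) → Derivable Δ

namespace Pr

variable {Γ Δ : Sequent} {σ : ℕ → Tm 0}

theorem weaken (h : Pr Γ) (hs : Γ ⊆ Δ) : Pr Δ :=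
  fun σ E h1 h2 => h σ E h1 fun φ hφ => h2 φ (hs hφ)

theorem derivable_insert {φ : Fml 0} (h : Pr (insert φ Γ)) (hσ : ∀ x, (σ x).fv ⊆ Sequent.fv Δ)
    (hΓ : ∀ φ ∈ Γ, φ.subst (ofFree σ) ∈ Δ) : Derivable (insert (φ.subst (ofFree σ)) Δ) := by
  refine h σ _ (fun x => (hσ x).trans ?_) fun ψ hψ => ?_
  · rw [Sequent.fv_insert]; exact Set.subset_union_right
  · rcases Finset.mem_insert.1 hψ with rfl | hψ
    · exact Finset.mem_insert_self _ _
    · exact Finset.mem_insert_of_mem (hΓ ψ hψ)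

theorem initial {L : Fml 0} (hL : L.IsLiteral) (h1 : L ∈ Γ) (h2 : L.compl ∈ Γ) : Pr Γ :=
  fun σ Δ _ hΓ => .of_rule (.initial Δ _ (hL.subst _) (hΓ _ h1)
    (by rw [Fml.subst_compl]; exact hΓ _ h2)) (by simp)

theorem orLeft {φ ψ : Fml 0} (h : Pr (insert φ Γ)) (hm : φ.or ψ ∈ Γ) : Pr Γ := by
  intro σ Δ hσ hΓ
  have h' := h.derivable_insert hσ hΓ
  by_cases hmem : φ.subst (ofFree σ) ∈ Δ
  · rwa [Finset.insert_eq_of_mem hmem] at h'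
  · exact .of_rule (.orLeft Δ _ _ (hΓ _ hm) hmem) (by simpa using h')

theorem orRight {φ ψ : Fml 0} (h : Pr (insert ψ Γ)) (hm : φ.or ψ ∈ Γ) : Pr Γ := by
  intro σ Δ hσ hΓ
  have h' := h.derivable_insert hσ hΓ
  by_cases hmem : ψ.subst (ofFree σ) ∈ Δ
  · rwa [Finset.insert_eq_of_mem hmem] at h'
  · exact .of_rule (.orRight Δ _ _ (hΓ _ hm) hmem) (by simpa using h')

theorem and {φ ψ : Fml 0} (h1 : Pr (insert φ Γ)) (h2 : Pr (insert ψ Γ)) (hm : φ.and ψ ∈ Γ) :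
    Pr Γ := by
  intro σ Δ hσ hΓ
  have h1' := h1.derivable_insert hσ hΓ
  have h2' := h2.derivable_insert hσ hΓ
  by_cases hmem1 : φ.subst (ofFree σ) ∈ Δ
  · rwa [Finset.insert_eq_of_mem hmem1] at h1'
  by_cases hmem2 : ψ.subst (ofFree σ) ∈ Δ
  · rwa [Finset.insert_eq_of_mem hmem2] at h2'
  exact .of_rule (.and Δ _ _ (hΓ _ hm) hmem1 hmem2) (by simpa using ⟨h1', h2'⟩)

theorem fv_subst_subset (hσ : ∀ x, (σ x).fv ⊆ Sequent.fv Δ) (u : Tm 0) :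
    Tm.fv (u.subst (ofFree σ)) ⊆ Sequent.fv Δ := by
  intro x hx
  obtain ⟨y | i, -, h⟩ := (Tm.mem_fv_subst _ _ _).1 hx
  · exact hσ y h
  · exact i.elim0

theorem ex {φ : Fml 1} (u : Tm 0) (h : Pr (insert (φ.inst u) Γ)) (hm : Fml.ex φ ∈ Γ) :
    Pr Γ := by
  intro σ Δ hσ hΓ
  have h' := h.derivable_insert hσ hΓ
  rw [Fml.inst_subst_ofFree] at h'
  by_cases hmem : (φ.subst (Fml.liftSubst (ofFree σ))).inst (u.subst (ofFree σ)) ∈ Δ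
  · rwa [Finset.insert_eq_of_mem hmem] at h'
  · exact .of_rule (.ex Δ _ _ (hΓ _ hm) (fv_subst_subset hσ u) hmem) (by simpa using h')

theorem fv_update_subset {a : ℕ} {v : Tm 0} (hσ : ∀ x, (σ x).fv ⊆ Sequent.fv Δ)
    (hv : v.fv ⊆ Sequent.fv Δ) (x : ℕ) : (Function.update σ a v x).fv ⊆ Sequent.fv Δ := by
  rcases eq_or_ne x a with rfl | hx
  · rwa [Function.update_self]
  · rw [Function.update_of_ne hx]; exact hσ x

theorem subst_update_mem {a : ℕ} {v : Tm 0} (hΓ : ∀ φ ∈ Γ, φ.subst (ofFree σ) ∈ Δ)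
    (ha : a ∉ Sequent.fv Γ) : ∀ φ ∈ Γ, φ.subst (ofFree (Function.update σ a v)) ∈ Δ := by
  intro φ hφ
  rw [Fml.subst_ofFree_congr φ (τ := σ)]
  · exact hΓ φ hφ
  · intro x hx
    refine Function.update_of_ne ?_ _ _
    rintro rfl
    exact ha (Sequent.mem_fv.2 ⟨φ, hφ, hx⟩)

/-- If the bound variable does not occur, so that the eigenvariable would not occur in the
premise, it is replaced by a constant. -/
theorem all {φ : Fml 1} (a : ℕ) (ha : a ∉ Sequent.fv Γ)
    (h : Pr (insert (φ.inst (Tm.fvar a)) Γ)) (hm : Fml.all φ ∈ Γ) : Pr Γ := by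
  intro σ Δ hσ hΓ
  have haφ : a ∉ φ.fv := fun h' => ha (Sequent.mem_fv.2 ⟨_, hm, h'⟩)
  set A : Fml 1 := φ.subst (Fml.liftSubst (ofFree σ)) with hA
  obtain ⟨a', ha'⟩ := Sequent.exists_notMem_fv Δ
  have key : ∀ v : Tm 0, v.fv ⊆ Sequent.fv (insert (A.inst v) Δ) →
      Derivable (insert (A.inst v) Δ) := by
    intro v hv
    have he : (φ.inst (Tm.fvar a)).subst (ofFree (Function.update σ a v)) = A.inst v := by
      rw [Fml.inst_subst_update _ _ _ _ haφ, fvar_subst_update]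
    refine h (Function.update σ a v) _ (fv_update_subset (fun x => (hσ x).trans ?_) hv)
      fun ψ hψ => ?_
    · rw [Sequent.fv_insert]; exact Set.subset_union_right
    · rcases Finset.mem_insert.1 hψ with rfl | hψ
      · rw [he]; exact Finset.mem_insert_self _ _
      · exact Finset.mem_insert_of_mem (subst_update_mem hΓ ha ψ hψ)
  have hD : Derivable (insert (A.inst (Tm.fvar a')) Δ) := by
    by_cases h0 : Sum.inr 0 ∈ A.vars
    · refine key _ ?_
      rw [Sequent.fv_insert]
      exact (Fml.fv_subset_fv_inst_of_mem_vars h0 _).trans Set.subset_union_left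
    · rw [Fml.inst_eq_of_notMem_vars h0 _ (Tm.const 0)]
      exact key _ (by simp)
  by_cases hmem : A.inst (Tm.fvar a') ∈ Δ
  · rwa [Finset.insert_eq_of_mem hmem] at hD
  · exact .of_rule (.all Δ A a' (hΓ _ hm) ha' hmem) (by simpa using hD)

theorem trueSentence {φ : Fml 0} (hφ : φ ∈ ThN) (h : Pr (insert φ.compl Γ)) : Pr Γ := by
  intro σ Δ hσ hΓ
  have h' := h.derivable_insert hσ hΓ
  rw [Fml.subst_ofFree_of_fv_eq_empty (by rw [Fml.fv_compl]; exact hφ.1)] at h'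
  by_cases hmem : φ.compl ∈ Δ
  · rwa [Finset.insert_eq_of_mem hmem] at h'
  · exact .of_rule (.trueSentence Δ φ hφ hmem) (by simpa using h')

/-- If the induction variable does not occur, the induction degenerates to a cut. -/
theorem induction {φ : Fml 1} (hφ : φ.IsPSigma 1) (a : ℕ) (t : Tm 0) (ha : a ∉ Sequent.fv Γ)
    (haφ : a ∉ φ.fv) (h0 : Pr (insert (φ.inst (Tm.const 0)) Γ))
    (h1 : Pr (insert (φ.inst (Tm.fvar a)).compl (insert (φ.inst (Tm.fvar a).succ) Γ)))
    (h2 : Pr (insert (φ.inst t).compl Γ)) : Pr Γ := by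
  intro σ Δ hσ hΓ
  have h0' := h0.derivable_insert hσ hΓ
  have h2' := h2.derivable_insert hσ hΓ
  rw [← Fml.subst_compl] at h2'
  rw [Fml.inst_subst_ofFree] at h0' h2'
  set A : Fml 1 := φ.subst (Fml.liftSubst (ofFree σ)) with hA
  have hAP : A.IsPSigma 1 := hφ.subst _
  have hAfv : A.fv ⊆ Sequent.fv Δ := by
    intro x hx
    obtain ⟨y | i, -, h⟩ := (Fml.mem_fv_subst _ _ _).1 hx
    · exact hσ y (by simpa [Fml.liftSubst, ofFree] using h)
    · obtain rfl : i = 0 := Fin.fin_one_eq_zero i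
      simp [Fml.liftSubst] at h
  rw [Tm.const_subst] at h0'
  have hs : Tm.fv (t.subst (ofFree σ)) ⊆ Sequent.fv Δ := fv_subst_subset hσ t
  generalize t.subst (ofFree σ) = s at h2' hs
  have hfv0 : (A.inst (Tm.const 0)).fv ⊆ Sequent.fv Δ :=
    (A.fv_inst_subset _).trans (Set.union_subset hAfv (by simp))
  have hfvs : (A.inst s).fv ⊆ Sequent.fv Δ :=
    (A.fv_inst_subset _).trans (Set.union_subset hAfv hs)
  by_cases hm0 : A.inst (Tm.const 0) ∈ Δ
  · rwa [Finset.insert_eq_of_mem hm0] at h0'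
  by_cases hm2 : (A.inst s).compl ∈ Δ
  · rwa [Finset.insert_eq_of_mem hm2] at h2'
  by_cases hv : Sum.inr 0 ∈ A.vars
  · obtain ⟨a', ha'⟩ := Sequent.exists_notMem_fv Δ
    have hE : Sequent.fv (insert (A.inst (Tm.fvar a')).compl
        (insert (A.inst (Tm.fvar a').succ) Δ)) = Sequent.fv Δ ∪ {a'} := by
      rw [Sequent.fv_insert, Sequent.fv_insert, Fml.fv_compl]
      refine Set.Subset.antisymm (Set.union_subset ?_ (Set.union_subset ?_
        Set.subset_union_left)) (Set.union_subset ?_ ?_)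
      · exact (A.fv_inst_subset _).trans (Set.union_subset_union hAfv (by simp))
      · exact (A.fv_inst_subset _).trans (Set.union_subset_union hAfv (by simp))
      · exact Set.subset_union_right.trans Set.subset_union_right
      · refine Set.Subset.trans ?_ Set.subset_union_left
        simpa using Fml.fv_subset_fv_inst_of_mem_vars hv (Tm.fvar a')
    have h1' : Derivable (insert (A.inst (Tm.fvar a')).compl
        (insert (A.inst (Tm.fvar a').succ) Δ)) := by
      refine h1 (Function.update σ a (Tm.fvar a')) _ (fv_update_subset (fun x => ?_) ?_)
        fun ψ hψ => ?_
      · rw [hE]; exact (hσ x).trans Set.subset_union_left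
      · rw [hE]; simp
      · rw [Finset.mem_insert, Finset.mem_insert] at hψ
        rcases hψ with rfl | rfl | hψ
        · rw [← Fml.subst_compl, Fml.inst_subst_update _ _ _ _ haφ, fvar_subst_update]
          exact Finset.mem_insert_self _ _
        · rw [Fml.inst_subst_update _ _ _ _ haφ, Tm.succ_subst, fvar_subst_update]
          exact Finset.mem_insert_of_mem (Finset.mem_insert_self _ _)
        · exact Finset.mem_insert_of_mem
            (Finset.mem_insert_of_mem (subst_update_mem hΓ ha ψ hψ))
    refine .of_rule (.induction Δ A a' s hAP (Fml.fv_subset_fv_inst_of_mem_vars hv s) hm0 hm2 ha'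
      ?_ ?_ hE) (by simpa using ⟨h0', h1', h2'⟩)
    · rw [Sequent.fv_insert]; exact Set.union_eq_right.2 hfv0
    · rw [Sequent.fv_insert, Fml.fv_compl]; exact Set.union_eq_right.2 hfvs
  · rw [Fml.inst_eq_of_notMem_vars hv s (Tm.const 0)] at h2' hm2 hfvs
    refine .of_rule (.cut Δ (A.inst (Tm.const 0)) (hAP.subst _) hm0 hm2 ?_ ?_)
      (by simpa using ⟨h0', h2'⟩)
    · rw [Sequent.fv_insert]; exact Set.union_eq_right.2 hfv0
    · rw [Sequent.fv_insert, Fml.fv_compl]; exact Set.union_eq_right.2 hfv0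

end Pr

/-! ### Truth values of formulas as closed sets of sequents -/

/-- The sequents whose union with every member of `A` is derivable. -/
def perp (A : Set Sequent) : Set Sequent := {Δ | ∀ Γ ∈ A, Pr (Γ ∪ Δ)}

theorem perp_anti {A B : Set Sequent} (h : A ⊆ B) : perp B ⊆ perp A :=
  fun _ hΔ Γ hΓ => hΔ Γ (h hΓ)

theorem subset_perp_perp (A : Set Sequent) : A ⊆ perp (perp A) := fun Γ hΓ Δ hΔ => by
  rw [Finset.union_comm]
  exact hΔ Γ hΓ

theorem perp_perp_perp (A : Set Sequent) : perp (perp (perp A)) = perp A :=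
  (perp_anti (subset_perp_perp A)).antisymm (subset_perp_perp _)

theorem mem_perp_of_subset {A : Set Sequent} {Γ Δ : Sequent} (h : Γ ∈ perp A) (hs : Γ ⊆ Δ) :
    Δ ∈ perp A :=
  fun E hE => (h E hE).weaken (Finset.union_subset_union_right hs)

theorem pr_of_mem_of_mem_perp {A : Set Sequent} {Γ : Sequent} (h1 : Γ ∈ A) (h2 : Γ ∈ perp A) :
    Pr Γ := by
  have := h2 Γ h1
  rwa [Finset.union_self] at this

/-- The truth value of a formula under a substitution `σ`, as in phase semantics: the value of
the complement is the orthogonal of the value, and all values are closed. -/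
def Sem : {n : ℕ} → Fml n → (ℕ ⊕ Fin n → Tm 0) → Set Sequent
  | _, .rel R ts, σ => perp {{Fml.rel R fun i => (ts i).subst σ}}
  | _, .nrel R ts, σ => perp (perp {{Fml.rel R fun i => (ts i).subst σ}})
  | _, .memX t, σ => perp {{Fml.memX (t.subst σ)}}
  | _, .nmemX t, σ => perp (perp {{Fml.memX (t.subst σ)}})
  | _, .and φ ψ, σ => Sem φ σ ∩ Sem ψ σ
  | _, .or φ ψ, σ => perp (perp (Sem φ σ) ∩ perp (Sem ψ σ))
  | _, .all φ, σ => ⋂ u : Tm 0, Sem φ (consSubst u σ)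
  | _, .ex φ, σ => perp (⋂ u : Tm 0, perp (Sem φ (consSubst u σ)))

theorem sem_closed {n : ℕ} (φ : Fml n) (σ : ℕ ⊕ Fin n → Tm 0) :
    perp (perp (Sem φ σ)) = Sem φ σ := by
  suffices ∃ B, Sem φ σ = perp B by
    obtain ⟨B, hB⟩ := this
    rw [hB, perp_perp_perp]
  induction φ with
  | rel R ts => exact ⟨_, rfl⟩
  | nrel R ts => exact ⟨_, rfl⟩
  | memX t => exact ⟨_, rfl⟩
  | nmemX t => exact ⟨_, rfl⟩
  | and φ ψ h1 h2 =>
    obtain ⟨A, hA⟩ := h1 σ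
    obtain ⟨B, hB⟩ := h2 σ
    refine ⟨A ∪ B, ?_⟩
    ext Γ
    simp only [Sem, hA, hB, perp, Set.mem_inter_iff, Set.mem_ofPred_eq, Set.mem_union,
      or_imp, forall_and]
  | or φ ψ h1 h2 => exact ⟨_, rfl⟩
  | all φ ih =>
    choose A hA using fun u => ih (consSubst u σ)
    refine ⟨⋃ u, A u, ?_⟩
    ext Γ
    simp only [Sem, hA, perp, Set.mem_iInter, Set.mem_ofPred_eq, Set.mem_iUnion]
    exact ⟨fun h E ⟨u, hu⟩ => h u E hu, fun h u E hu => h E ⟨u, hu⟩⟩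
  | ex φ ih => exact ⟨_, rfl⟩

theorem mem_sem_of_subset {n : ℕ} {φ : Fml n} {σ : ℕ ⊕ Fin n → Tm 0} {Γ Δ : Sequent}
    (h : Γ ∈ Sem φ σ) (hs : Γ ⊆ Δ) : Δ ∈ Sem φ σ := by
  rw [← sem_closed] at h ⊢
  exact mem_perp_of_subset h hs

theorem sem_compl {n : ℕ} (φ : Fml n) (σ : ℕ ⊕ Fin n → Tm 0) :
    Sem φ.compl σ = perp (Sem φ σ) := by
  induction φ with
  | rel R ts => rfl
  | nrel R ts => exact (perp_perp_perp _).symm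
  | memX t => rfl
  | nmemX t => exact (perp_perp_perp _).symm
  | and φ ψ h1 h2 => simp only [Fml.compl, Sem, h1, h2, sem_closed]
  | or φ ψ h1 h2 =>
    have := sem_closed (φ.compl.and ψ.compl) σ
    simp only [Fml.compl, Sem, h1, h2] at this ⊢
    exact this.symm
  | all φ ih => simp only [Fml.compl, Sem, ih, sem_closed]
  | ex φ ih =>
    have := sem_closed φ.compl.all σ
    simp only [Fml.compl, Sem, ih] at this ⊢
    exact this.symm

theorem sem_subst {n m : ℕ} (φ : Fml n) (τ : ℕ ⊕ Fin n → Tm m) (σ : ℕ ⊕ Fin m → Tm 0) :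
    Sem (φ.subst τ) σ = Sem φ fun i => (τ i).subst σ := by
  have key : ∀ {n m : ℕ} (τ : ℕ ⊕ Fin n → Tm m) (σ : ℕ ⊕ Fin m → Tm 0) (u : Tm 0),
      (fun i => (Fml.liftSubst τ i).subst (consSubst u σ)) =
        consSubst u fun i => (τ i).subst σ := by
    intro n m τ σ u
    funext i
    rcases i with x | i
    · exact lift_subst_consSubst _ _ _
    · induction i using Fin.cases with
      | zero => rfl
      | succ i => exact lift_subst_consSubst _ _ _
  induction φ generalizing m with
  | rel R ts => simp only [Fml.subst, Sem, term_subst_subst]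
  | nrel R ts => simp only [Fml.subst, Sem, term_subst_subst]
  | memX t => simp only [Fml.subst, Sem, term_subst_subst]
  | nmemX t => simp only [Fml.subst, Sem, term_subst_subst]
  | and φ ψ h1 h2 => simp only [Fml.subst, Sem, h1, h2]
  | or φ ψ h1 h2 => simp only [Fml.subst, Sem, h1, h2]
  | all φ ih => simp only [Fml.subst, Sem, ih, key]
  | ex φ ih => simp only [Fml.subst, Sem, ih, key]

/-- The truth value of a formula without bound variables outside. -/
def Val (φ : Fml 0) : Set Sequent := Sem φ Term.var

theorem sem_eq_val {n : ℕ} (φ : Fml n) (σ : ℕ ⊕ Fin n → Tm 0) : Sem φ σ = Val (φ.subst σ) := by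
  simp only [Val, sem_subst, term_subst_var]

theorem val_inst (φ : Fml 1) (u : Tm 0) : Val (φ.inst u) = Sem φ (consSubst u Term.var) := by
  rw [Val, Fml.inst, sem_subst]
  congr 1
  funext i
  rcases i with x | i
  · rfl
  · obtain rfl : i = 0 := Subsingleton.elim _ _
    exact term_subst_var u

theorem val_compl (φ : Fml 0) : Val φ.compl = perp (Val φ) := sem_compl _ _

theorem val_closed (φ : Fml 0) : perp (perp (Val φ)) = Val φ := sem_closed _ _

theorem sem_subset_sem_ex {n : ℕ} (φ : Fml (n + 1)) (σ : ℕ ⊕ Fin n → Tm 0) (u : Tm 0) :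
    Sem φ (consSubst u σ) ⊆ Sem (Fml.ex φ) σ := by
  intro Γ hΓ E hE
  rw [Finset.union_comm]
  exact Set.mem_iInter.1 hE u Γ hΓ

/-- If `β` is inferred from `α` by a rule with one premise, then every closed set with the member
`{α}` has the member `{β}`. -/
theorem singleton_mem_perp_perp {A : Set Sequent} {α β : Fml 0} (h : {α} ∈ A)
    (hrule : ∀ Γ, β ∈ Γ → Pr (insert α Γ) → Pr Γ) : {β} ∈ perp (perp A) := by
  intro E hE
  refine hrule _ (by simp) ((hE _ h).weaken ?_)
  intro x hx
  simp only [Finset.mem_union, Finset.mem_singleton, Finset.mem_insert] at hx ⊢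
  tauto

/-- The truth value of a formula lies between its complement and the orthogonal of the formula.
This is what makes the semantics yield derivations without cuts. -/
theorem compl_mem_sem_and_pr_of_mem_sem {n : ℕ} (φ : Fml n) (σ : ℕ ⊕ Fin n → Tm 0) :
    {(φ.subst σ).compl} ∈ Sem φ σ ∧ ∀ Γ ∈ Sem φ σ, Pr (insert (φ.subst σ) Γ) := by
  have fresh : ∀ (φ : Fml 1) (Γ : Sequent), Fml.all φ ∈ Γ →
      (∀ u, Pr (insert (φ.inst u) Γ)) → Pr Γ := by
    intro φ Γ hm h
    obtain ⟨a, ha⟩ := Sequent.exists_notMem_fv Γ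
    exact (h (Tm.fvar a)).all a ha hm
  have sub : ∀ (α β : Fml 0) (Γ : Sequent), insert α Γ ⊆ insert α (insert β Γ) := fun α β Γ =>
    Finset.insert_subset_insert _ (Finset.subset_insert _ _)
  induction φ with
  | rel R ts =>
    refine ⟨fun Γ hΓ => ?_, fun Γ hΓ => (hΓ _ rfl).weaken (by simp [Fml.subst])⟩
    obtain rfl := hΓ
    exact .initial (L := Fml.rel R fun i => (ts i).subst σ) trivial (by simp)
      (by simp [Fml.subst, Fml.compl])
  | nrel R ts =>
    refine ⟨subset_perp_perp _ rfl, fun Γ hΓ => hΓ {Fml.nrel R fun i => (ts i).subst σ} ?_⟩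
    rintro _ rfl
    exact .initial (L := Fml.rel R fun i => (ts i).subst σ) trivial (by simp)
      (by simp [Fml.compl])
  | memX t =>
    refine ⟨fun Γ hΓ => ?_, fun Γ hΓ => (hΓ _ rfl).weaken (by simp [Fml.subst])⟩
    obtain rfl := hΓ
    exact .initial (L := Fml.memX (t.subst σ)) trivial (by simp)
      (by simp [Fml.subst, Fml.compl])
  | nmemX t =>
    refine ⟨subset_perp_perp _ rfl, fun Γ hΓ => hΓ {Fml.nmemX (t.subst σ)} ?_⟩
    rintro _ rfl
    exact .initial (L := Fml.memX (t.subst σ)) trivial (by simp) (by simp [Fml.compl])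
  | and φ ψ h1 h2 =>
    refine ⟨⟨?_, ?_⟩, fun Γ hΓ => ?_⟩
    · rw [← sem_closed]
      exact singleton_mem_perp_perp (h1 σ).1 fun Γ hm h => h.orLeft hm
    · rw [← sem_closed]
      exact singleton_mem_perp_perp (h2 σ).1 fun Γ hm h => h.orRight hm
    · exact .and (((h1 σ).2 Γ hΓ.1).weaken (sub _ _ _)) (((h2 σ).2 Γ hΓ.2).weaken (sub _ _ _))
        (Finset.mem_insert_self _ _)
  | or φ ψ h1 h2 =>
    refine ⟨fun Γ hΓ => ?_, fun Γ hΓ => hΓ {(φ.subst σ).or (ψ.subst σ)} ⟨?_, ?_⟩⟩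
    · refine .and (φ := (φ.subst σ).compl) (ψ := (ψ.subst σ).compl)
        ((hΓ.1 _ (h1 σ).1).weaken ?_) ((hΓ.2 _ (h2 σ).1).weaken ?_) (by simp [Fml.subst, Fml.compl])
      all_goals exact Finset.insert_subset_insert _ Finset.subset_union_left
    · intro Δ hΔ
      refine .orLeft (φ := φ.subst σ) (ψ := ψ.subst σ) (((h1 σ).2 Δ hΔ).weaken ?_) (by simp)
      exact Finset.insert_subset_insert _ Finset.subset_union_left
    · intro Δ hΔ
      refine .orRight (φ := φ.subst σ) (ψ := ψ.subst σ) (((h2 σ).2 Δ hΔ).weaken ?_) (by simp)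
      exact Finset.insert_subset_insert _ Finset.subset_union_left
  | all φ ih =>
    refine ⟨Set.mem_iInter.2 fun u => ?_, fun Γ hΓ => ?_⟩
    · rw [← sem_closed]
      refine singleton_mem_perp_perp (ih (consSubst u σ)).1 fun Γ hm h => .ex u ?_ hm
      rwa [← Fml.inst_compl, Fml.subst_liftSubst_inst]
    · refine fresh _ _ (Finset.mem_insert_self _ _) fun u => ?_
      rw [Fml.subst_liftSubst_inst]
      exact ((ih _).2 Γ (Set.mem_iInter.1 hΓ u)).weaken (sub _ _ _)
  | ex φ ih =>
    refine ⟨fun Γ hΓ => ?_, fun Γ hΓ => hΓ {Fml.ex (φ.subst (Fml.liftSubst σ))}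
      (Set.mem_iInter.2 fun u => ?_)⟩
    · refine fresh (φ.subst (Fml.liftSubst σ)).compl _ (by simp [Fml.subst, Fml.compl]) fun u => ?_
      rw [← Fml.inst_compl, Fml.subst_liftSubst_inst]
      refine (Set.mem_iInter.1 hΓ u _ (ih (consSubst u σ)).1).weaken ?_
      exact Finset.insert_subset_insert _ Finset.subset_union_left
    · intro Δ hΔ
      refine .ex u ?_ (φ := φ.subst (Fml.liftSubst σ)) (by simp)
      rw [Fml.subst_liftSubst_inst]
      refine ((ih _).2 Δ hΔ).weaken ?_
      exact Finset.insert_subset_insert _ Finset.subset_union_left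

theorem compl_mem_val (φ : Fml 0) : {φ.compl} ∈ Val φ := by
  have := (compl_mem_sem_and_pr_of_mem_sem φ Term.var).1
  rwa [Fml.subst_var] at this

theorem mem_val_compl (φ : Fml 0) : {φ} ∈ Val φ.compl := by
  simpa using compl_mem_val φ.compl

theorem pr_of_mem_val {φ : Fml 0} {Γ : Sequent} (h : Γ ∈ Val φ) : Pr (insert φ Γ) := by
  have := (compl_mem_sem_and_pr_of_mem_sem φ Term.var).2 Γ h
  rwa [Fml.subst_var] at this

/-! ### True formulas without `X` -/

theorem empty_mem_val_of_mem_ThN {φ : Fml 0} (h : φ ∈ ThN) : ∅ ∈ Val φ := by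
  rw [← val_closed]
  intro E hE
  rw [Finset.union_empty]
  exact .trueSentence h (hE _ (compl_mem_val φ))

namespace Fml

/-- Passing below one more quantifier, the variable of which does not occur. -/
def wk {n : ℕ} (φ : Fml n) : Fml (n + 1) :=
  φ.subst (Sum.elim Tm.fvar fun i => Tm.bvar i.succ)

/-- The closure of a formula by universal quantifiers, separated by vacuous existential ones so
that the quantifiers alternate. -/
def uclose : (n : ℕ) → Fml n → Fml 0
  | 0, φ => φ
  | n + 1, φ => uclose n (ex (wk (all φ)))

/-- A conjunction in `Δ₀(X)`, preceded by `i` blocks `∃∀`. -/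
def IsBlock : ℕ → {n : ℕ} → Fml n → Prop
  | 0, _, φ => φ.IsDelta0 ∧ ∃ α β, φ = and α β
  | i + 1, _, φ => ∃ ψ, φ = ex (all ψ) ∧ IsBlock i ψ

theorem IsBlock.subst {i n m : ℕ} {φ : Fml n} (h : IsBlock i φ) (σ : ℕ ⊕ Fin n → Tm m) :
    IsBlock i (φ.subst σ) := by
  induction i generalizing n m with
  | zero =>
    obtain ⟨h1, α, β, rfl⟩ := h
    exact ⟨h1.subst σ, _, _, rfl⟩
  | succ i ih =>
    obtain ⟨ψ, rfl, h⟩ := h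
    exact ⟨_, rfl, ih h _⟩

/-- The matrix is a conjunction, hence the innermost `∀` is not a bounded quantifier. -/
theorem IsBlock.isPSigma {i n : ℕ} {φ : Fml n} (h : IsBlock i φ) : φ.IsPSigma (2 * i) := by
  induction i generalizing n with
  | zero => exact .zero _ _ h.1
  | succ i ih =>
    obtain ⟨ψ, rfl, h⟩ := h
    refine .ex _ _ (.all _ _ (ih h) fun h' => ?_) fun h' => ?_
    · cases h' with
      | literal _ h' => exact h'.elim
      | ball t θ _ =>
        cases i with
        | zero =>
          obtain ⟨-, α, β, h⟩ := h
          cases h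
        | succ i =>
          obtain ⟨_, h, -⟩ := h
          cases h
    · cases h' with
      | literal _ h' => exact h'.elim

theorem IsBlock.uclose {n i : ℕ} {φ : Fml n} (h : IsBlock i φ) :
    IsBlock (i + n) (Fml.uclose n φ) := by
  induction n generalizing i with
  | zero => exact h
  | succ n ih =>
    have := ih (i := i + 1) (φ := ex (wk (all φ))) ⟨_, rfl, h.subst _⟩
    rwa [Nat.add_right_comm] at this

theorem XFree.subst {n m : ℕ} {φ : Fml n} (h : φ.XFree) (σ : ℕ ⊕ Fin n → Tm m) :
    (φ.subst σ).XFree := by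
  induction φ generalizing m with
  | rel R ts => trivial
  | nrel R ts => trivial
  | memX t => exact h.elim
  | nmemX t => exact h.elim
  | and φ ψ h1 h2 => exact ⟨h1 h.1 σ, h2 h.2 σ⟩
  | or φ ψ h1 h2 => exact ⟨h1 h.1 σ, h2 h.2 σ⟩
  | all φ ih => exact ih h _
  | ex φ ih => exact ih h _

theorem XFree.uclose {n : ℕ} {φ : Fml n} (h : φ.XFree) : (Fml.uclose n φ).XFree := by
  induction n with
  | zero => exact h
  | succ n ih => exact ih (XFree.subst (φ := Fml.all φ) h _)

theorem fv_uclose {n : ℕ} (φ : Fml n) (h : φ.fv = ∅) : (uclose n φ).fv = ∅ := by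
  induction n with
  | zero => exact h
  | succ n ih =>
    refine ih _ (Set.eq_empty_of_forall_notMem fun x hx => ?_)
    obtain ⟨y | i, hi, hx⟩ := (mem_fv_subst (all φ) _ x).1 hx
    · have : y ∈ φ.fv := (mem_fv_iff (all φ) y).2 hi
      rw [h] at this
      exact this
    · simp at hx

theorem holds_uclose {n : ℕ} (χ : Set ℕ) (e : ℕ → ℕ) (φ : Fml n)
    (h : ∀ b, φ.Holds χ e b) (b : Fin 0 → ℕ) : (uclose n φ).Holds χ e b := by
  induction n with
  | zero => exact h b
  | succ n ih =>
    refine ih _ fun b => ⟨0, ?_⟩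
    refine (holds_subst χ e _ (all φ) _ e b ?_).2 fun x => h _
    rintro (x | i) <;> rfl

theorem holds_compl {n : ℕ} (χ : Set ℕ) (e : ℕ → ℕ) (b : Fin n → ℕ) (φ : Fml n) :
    φ.compl.Holds χ e b ↔ ¬ φ.Holds χ e b := by
  induction φ with
  | rel R ts => rfl
  | nrel R ts => exact not_not.symm
  | memX t => rfl
  | nmemX t => exact not_not.symm
  | and φ ψ h1 h2 => simp only [compl, Holds, h1, h2]; tauto
  | or φ ψ h1 h2 => simp only [compl, Holds, h1, h2]; tauto
  | all φ ih => simp only [compl, Holds, ih]; exact not_forall.symm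
  | ex φ ih => simp only [compl, Holds, ih]; exact not_exists.symm

theorem holds_inst (χ : Set ℕ) (e : ℕ → ℕ) (φ : Fml 1) (u : Tm 0) (b : Fin 0 → ℕ) :
    (φ.inst u).Holds χ e b ↔ φ.Holds χ e fun _ => u.realize (Sum.elim e b) := by
  refine holds_subst _ _ _ _ _ _ _ ?_
  rintro (x | i) <;> rfl

theorem XFree.compl {n : ℕ} {φ : Fml n} (h : φ.XFree) : φ.compl.XFree := by
  induction φ with
  | rel R ts => trivial
  | nrel R ts => trivial
  | memX t => exact h.elim
  | nmemX t => exact h.elim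
  | and φ ψ h1 h2 => exact ⟨h1 h.1, h2 h.2⟩
  | or φ ψ h1 h2 => exact ⟨h1 h.1, h2 h.2⟩
  | all φ ih => exact ih h
  | ex φ ih => exact ih h

end Fml

theorem empty_mem_sem_of_uclose {n : ℕ} (φ : Fml n) (h : ∀ σ, ∅ ∈ Sem (Fml.uclose n φ) σ)
    (σ : ℕ ⊕ Fin n → Tm 0) : ∅ ∈ Sem φ σ := by
  induction n with
  | zero => exact h σ
  | succ n ih =>
    have hσ : σ = consSubst (σ (Sum.inr 0))
        (Sum.elim (fun x => σ (Sum.inl x)) fun i => σ (Sum.inr i.succ)) := by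
      funext i
      rcases i with x | i
      · rfl
      · induction i using Fin.cases with
        | zero => rfl
        | succ i => rfl
    rw [hσ]
    have := ih _ h (Sum.elim (fun x => σ (Sum.inl x)) fun i => σ (Sum.inr i.succ))
    have hwk : ∀ (u : Tm 0) (ν : ℕ ⊕ Fin n → Tm 0),
        Sem (Fml.wk (Fml.all φ)) (consSubst u ν) = Sem (Fml.all φ) ν := by
      intro u ν
      rw [Fml.wk, sem_subst]
      congr 1
      funext i
      rcases i with x | i <;> rfl
    have hne : Nonempty (Tm 0) := ⟨Tm.const 0⟩
    rw [Sem] at this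
    simp only [hwk, Set.iInter_const, sem_closed] at this
    exact Set.mem_iInter.1 this _

/-- A true `Δ₀`-formula has the greatest truth value. -/
theorem empty_mem_val_of_holds {θ : Fml 0} (h1 : θ.XFree) (h2 : θ.IsDelta0)
    (h3 : ∀ e b, θ.Holds ∅ e b) : ∅ ∈ Val θ := by
  obtain ⟨N, hN⟩ := θ.finite_fv.bddAbove
  let τ : ℕ ⊕ Fin 0 → Tm (N + 1) :=
    Sum.elim (fun x => if hx : x < N + 1 then Tm.bvar ⟨x, hx⟩ else Tm.const 0) Fin.elim0
  have hfv : ((Fml.and θ θ).subst τ).fv = ∅ := by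
    refine Set.eq_empty_of_forall_notMem fun x hx => ?_
    obtain ⟨y | i, -, hx⟩ := (Fml.mem_fv_subst _ _ x).1 hx
    · simp only [τ, Sum.elim_inl] at hx
      split_ifs at hx <;> simp at hx
    · exact i.elim0
  have hTh : Fml.uclose (N + 1) ((Fml.and θ θ).subst τ) ∈ ThN := by
    refine ⟨Fml.fv_uclose _ hfv, (Fml.XFree.subst (φ := Fml.and θ θ) ⟨h1, h1⟩ τ).uclose,
      ⟨_, (Fml.IsBlock.uclose (i := 0) ⟨(h2.and _ _ h2).subst τ, _, _, rfl⟩).isPSigma⟩,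
      Fml.holds_uclose _ _ _ (fun b => ?_) _⟩
    have : ∀ i, (τ i).realize (Sum.elim (fun _ => 0) b) =
        Sum.elim (fun x => (τ (Sum.inl x)).realize (Sum.elim (fun _ => 0) b)) Fin.elim0 i := by
      rintro (x | i)
      · rfl
      · exact i.elim0
    exact (Fml.holds_subst _ _ _ _ _ _ _ this).2 ⟨h3 _ _, h3 _ _⟩
  have key := empty_mem_sem_of_uclose ((Fml.and θ θ).subst τ) (fun σ => by
    rw [sem_eq_val]
    have : (Fml.uclose (N + 1) ((Fml.and θ θ).subst τ)).subst σ =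
        Fml.uclose (N + 1) ((Fml.and θ θ).subst τ) := by
      conv_rhs => rw [← Fml.subst_var (Fml.uclose (N + 1) ((Fml.and θ θ).subst τ))]
      refine Fml.subst_congr _ ?_
      rintro (x | i) hi
      · have := (Fml.mem_fv_iff _ _).2 hi
        rw [hTh.1] at this
        exact this.elim
      · exact i.elim0
    rw [this]
    exact empty_mem_val_of_mem_ThN hTh) (Sum.elim Tm.fvar fun i => Tm.fvar i)
  rw [sem_subst, sem_eq_val] at key
  have : (Fml.and θ θ).subst (fun i => (τ i).subst (Sum.elim Tm.fvar fun i => Tm.fvar i)) =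
      Fml.and θ θ := by
    conv_rhs => rw [← Fml.subst_var (Fml.and θ θ)]
    refine Fml.subst_congr _ ?_
    rintro (x | i) hi
    · have hx : x ∈ θ.fv := (Fml.mem_fv_iff _ _).2 (by simpa [Fml.vars] using hi)
      have hx : x < N + 1 := Nat.lt_succ_of_le (hN hx)
      simp only [τ, Sum.elim_inl, dif_pos hx]
      rfl
    · exact i.elim0
  rw [this] at key
  exact key.1

/-! ### Replacing `X` by a predicate which respects equality -/

namespace Fml

/-- The formula with `t ∈ X` replaced by `∃ y ≤ t. (t = y ∧ y ∈ X)`. The rules do not provide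
`t ∈ X` from `s = t` and `s ∈ X`; the translation makes this derivable. -/
def star : {n : ℕ} → Fml n → Fml n
  | _, rel R ts => rel R ts
  | _, nrel R ts => nrel R ts
  | _, memX t =>
      ex (and (le (Tm.bvar 0) t.lift) (and (eq t.lift (Tm.bvar 0)) (memX (Tm.bvar 0))))
  | _, nmemX t =>
      all (or (le (Tm.bvar 0) t.lift).compl
        (or (eq t.lift (Tm.bvar 0)).compl (nmemX (Tm.bvar 0))))
  | _, and φ ψ => and φ.star ψ.star
  | _, or φ ψ => or φ.star ψ.star
  | _, all φ => all φ.star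
  | _, ex φ => ex φ.star

theorem star_compl {n : ℕ} (φ : Fml n) : φ.compl.star = φ.star.compl := by
  induction φ with
  | rel R ts => rfl
  | nrel R ts => rfl
  | memX t => rfl
  | nmemX t => simp only [compl, star, compl_compl]
  | and φ ψ h1 h2 => simp only [compl, star, h1, h2]
  | or φ ψ h1 h2 => simp only [compl, star, h1, h2]
  | all φ ih => simp only [compl, star, ih]
  | ex φ ih => simp only [compl, star, ih]

theorem star_subst {n m : ℕ} (φ : Fml n) (σ : ℕ ⊕ Fin n → Tm m) :
    (φ.subst σ).star = φ.star.subst σ := by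
  induction φ generalizing m with
  | rel R ts => rfl
  | nrel R ts => rfl
  | memX t =>
    simp only [subst, star, subst_le, subst_eq, Tm.lift_subst_liftSubst, Tm.bvar_subst]
    rfl
  | nmemX t =>
    simp only [subst, star, ← subst_compl, subst_le, subst_eq, Tm.lift_subst_liftSubst,
      Tm.bvar_subst]
    rfl
  | and φ ψ h1 h2 => simp only [subst, star, h1, h2]
  | or φ ψ h1 h2 => simp only [subst, star, h1, h2]
  | all φ ih => simp only [subst, star, ih]
  | ex φ ih => simp only [subst, star, ih]

theorem XFree.star_eq {n : ℕ} {φ : Fml n} (h : φ.XFree) : φ.star = φ := by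
  induction φ with
  | rel R ts => rfl
  | nrel R ts => rfl
  | memX t => exact h.elim
  | nmemX t => exact h.elim
  | and φ ψ h1 h2 => simp only [star, h1 h.1, h2 h.2]
  | or φ ψ h1 h2 => simp only [star, h1 h.1, h2 h.2]
  | all φ ih => simp only [star, ih h]
  | ex φ ih => simp only [star, ih h]

theorem IsDelta0.star {n : ℕ} {φ : Fml n} (h : φ.IsDelta0) : φ.star.IsDelta0 := by
  induction h with
  | literal φ h =>
    cases φ with
    | rel R ts => exact .literal _ h
    | nrel R ts => exact .literal _ h
    | memX t => exact .bex t _ (.and _ _ (.literal _ trivial) (.literal _ trivial))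
    | nmemX t => exact .ball t _ (.or _ _ (.literal _ trivial) (.literal _ trivial))
    | _ => exact h.elim
  | and φ ψ _ _ h1 h2 => exact .and _ _ h1 h2
  | or φ ψ _ _ h1 h2 => exact .or _ _ h1 h2
  | ball t φ _ ih => exact .ball t _ ih
  | bex t φ _ ih => exact .bex t _ ih

theorem IsPSigma.star {n : ℕ} {φ : Fml n} (h : φ.IsPSigma 1) : φ.star.IsPSigma 1 := by
  rw [isPSigma_one_iff] at h ⊢
  obtain ⟨θ, hθ, rfl, h⟩ := h
  refine ⟨_, hθ.star, rfl, fun h' => h ?_⟩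
  obtain ⟨t, ψ, -, he⟩ := (isDelta0_ex_iff _).1 h'
  rw [isDelta0_ex_iff]
  cases θ with
  | and α β =>
    simp only [Fml.star, and.injEq] at he
    refine ⟨t, β, isDelta0_and_right hθ, ?_⟩
    cases α with
    | rel R ts => rw [← he.1]; rfl
    | _ => simp [Fml.star, le] at he
  | _ => simp [Fml.star] at he

end Fml

/-! ### Transport of truth values along equations -/

/-- Adjoining `Δ` leads from `A` to `B`. -/
def Transports (Δ : Sequent) (A B : Set Sequent) : Prop := ∀ Γ ∈ A, Γ ∪ Δ ∈ B

namespace Transports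

variable {Δ : Sequent} {A A' B B' : Set Sequent}

theorem perp (h : Transports Δ A B) : Transports Δ (perp B) (TIGame.perp A) := by
  intro Γ hΓ E hE
  refine (hΓ _ (h E hE)).weaken ?_
  intro x hx
  simp only [Finset.mem_union] at hx ⊢
  tauto

theorem inter (h1 : Transports Δ A B) (h2 : Transports Δ A' B') :
    Transports Δ (A ∩ A') (B ∩ B') := fun Γ hΓ => ⟨h1 Γ hΓ.1, h2 Γ hΓ.2⟩

theorem or (h1 : Transports Δ A B) (h2 : Transports Δ A' B') :
    Transports Δ (TIGame.perp (TIGame.perp A ∩ TIGame.perp A'))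
      (TIGame.perp (TIGame.perp B ∩ TIGame.perp B')) := (h1.perp.inter h2.perp).perp

theorem iInter {ι : Type} {A B : ι → Set Sequent} (h : ∀ i, Transports Δ (A i) (B i)) :
    Transports Δ (⋂ i, A i) (⋂ i, B i) := fun Γ hΓ =>
  Set.mem_iInter.2 fun i => h i Γ (Set.mem_iInter.1 hΓ i)

theorem refl {n : ℕ} (φ : Fml n) (σ : ℕ ⊕ Fin n → Tm 0) : Transports Δ (Sem φ σ) (Sem φ σ) :=
  fun _ hΓ => mem_sem_of_subset hΓ Finset.subset_union_left

end Transports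

/-- Equality axioms for `Δ₀`-formulas without `X`, which are true formulas. -/
theorem transports_val_inst {ψ : Fml 1} (h1 : ψ.XFree) (h2 : ψ.IsDelta0) {s t : Tm 0}
    {Δ : Sequent} (hΔ : Δ ∈ Val (Fml.eq s t)) : Transports Δ (Val (ψ.inst s)) (Val (ψ.inst t)) := by
  have key : ∅ ∈ Val ((Fml.eq s t).compl.or ((ψ.inst s).compl.or (ψ.inst t))) := by
    refine empty_mem_val_of_holds ⟨trivial, (h1.subst _).compl, h1.subst _⟩
      (.or _ _ (.literal _ trivial) (.or _ _ (h2.subst _).compl (h2.subst _))) fun e b => ?_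
    by_cases he : s.realize (Sum.elim e b) = t.realize (Sum.elim e b)
    · refine Or.inr ?_
      rw [Fml.Holds, Fml.holds_compl, Fml.holds_inst, Fml.holds_inst, he]
      exact (Classical.em _).symm
    · exact Or.inl he
  intro Γ hΓ
  rw [← val_closed]
  intro E hE
  have key := key (E ∪ (Γ ∪ Δ)) ⟨?_, ?_⟩
  · rwa [Finset.union_empty] at key
  · change _ ∈ perp (Val (Fml.eq s t).compl)
    rw [val_compl, val_closed]
    exact mem_sem_of_subset hΔ (Finset.subset_union_right.trans Finset.subset_union_right)
  · refine subset_perp_perp _ ⟨?_, ?_⟩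
    · change _ ∈ perp (Val (ψ.inst s).compl)
      rw [val_compl, val_closed]
      exact mem_sem_of_subset hΓ (Finset.subset_union_left.trans Finset.subset_union_right)
    · exact mem_perp_of_subset hE Finset.subset_union_left

/-- The substitution with values `(ν i)(s)`. -/
def instSubst {n : ℕ} (ν : ℕ ⊕ Fin n → Tm 1) (s : Tm 0) : ℕ ⊕ Fin n → Tm 0 :=
  fun i => (ν i).subst (consSubst s Term.var)

/-- The shape `instSubst ν s`, with `s` left open, is preserved below a quantifier. -/
theorem consSubst_instSubst {n : ℕ} (ν : ℕ ⊕ Fin n → Tm 1) (u : Tm 0) :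
    ∃ ν' : ℕ ⊕ Fin (n + 1) → Tm 1, (∀ s, consSubst u (instSubst ν s) = instSubst ν' s) := by
  refine ⟨Sum.elim (fun x => ν (Sum.inl x))
    (Fin.cons u.lift fun i => ν (Sum.inr i) : Fin (n + 1) → Tm 1), fun s => ?_⟩
  funext i
  rcases i with x | i
  · rfl
  · induction i using Fin.cases with
    | zero => exact ((lift_subst_consSubst _ _ _).trans (term_subst_var _)).symm
    | succ i => rfl

theorem sem_instSubst {n : ℕ} (φ : Fml n) (ν : ℕ ⊕ Fin n → Tm 1) (s : Tm 0) :
    Sem φ (instSubst ν s) = Val ((φ.subst ν).inst s) := by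
  rw [val_inst, sem_subst]
  rfl

/-- The equality axioms hold for the truth values of translated formulas. -/
theorem transports_sem_star {s t : Tm 0} {Δ : Sequent} (hΔ : Δ ∈ Val (Fml.eq s t)) {n : ℕ}
    (φ : Fml n) (ν : ℕ ⊕ Fin n → Tm 1) :
    Transports Δ (Sem φ.star (instSubst ν s)) (Sem φ.star (instSubst ν t)) := by
  have lit : ∀ {n : ℕ} (L : Fml n) (ν : ℕ ⊕ Fin n → Tm 1), L.XFree → L.IsLiteral →
      Transports Δ (Sem L (instSubst ν s)) (Sem L (instSubst ν t)) := by
    intro n L ν h1 h2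
    rw [sem_instSubst, sem_instSubst]
    exact transports_val_inst (h1.subst _) (.literal _ (h2.subst _)) hΔ
  induction φ with
  | rel R ts => exact lit _ _ trivial trivial
  | nrel R ts => exact lit _ _ trivial trivial
  | memX r =>
    refine (Transports.iInter fun u => (Transports.inter ?_ (Transports.inter ?_ ?_)).perp).perp
    · obtain ⟨ν', h⟩ := consSubst_instSubst ν u
      rw [h, h]; exact lit _ _ trivial trivial
    · obtain ⟨ν', h⟩ := consSubst_instSubst ν u
      rw [h, h]; exact lit _ _ trivial trivial
    · exact Transports.refl (Fml.memX (Tm.bvar 0)) (consSubst u (instSubst ν s))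
  | nmemX r =>
    refine Transports.iInter fun u => Transports.or ?_ (Transports.or ?_ ?_)
    · obtain ⟨ν', h⟩ := consSubst_instSubst ν u
      rw [h, h]; exact lit _ _ trivial trivial
    · obtain ⟨ν', h⟩ := consSubst_instSubst ν u
      rw [h, h]; exact lit _ _ trivial trivial
    · exact Transports.refl (Fml.nmemX (Tm.bvar 0)) (consSubst u (instSubst ν s))
  | and φ ψ h1 h2 => exact (h1 ν).inter (h2 ν)
  | or φ ψ h1 h2 => exact (h1 ν).or (h2 ν)
  | all φ ih =>
    refine Transports.iInter fun u => ?_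
    obtain ⟨ν', h⟩ := consSubst_instSubst ν u
    rw [h, h]; exact ih ν'
  | ex φ ih =>
    refine (Transports.iInter fun u => Transports.perp ?_).perp
    obtain ⟨ν', h⟩ := consSubst_instSubst ν u
    rw [h, h]; exact ih ν'

/-! ### Soundness of provability -/

theorem inductionAxiom_star (φ : Fml 1) :
    (inductionAxiom φ).star = inductionAxiom φ.star := by
  simp only [inductionAxiom, Fml.star, Fml.star_compl, Fml.inst, Fml.star_subst]

theorem inductionAxiom_subst (φ : Fml 1) (σ : ℕ ⊕ Fin 0 → Tm 0) :
    (inductionAxiom φ).subst σ = inductionAxiom (φ.subst (Fml.liftSubst σ)) := by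
  have h : ∀ {m k : ℕ} (u : Tm m) (τ : ℕ ⊕ Fin m → Tm k) (u' : Tm k), u.subst τ = u' →
      (∀ x, (Fml.liftSubst σ (Sum.inl x)).subst (Sum.elim Tm.fvar fun _ => u') =
        τ (Sum.inl x)) →
      (φ.inst u).subst τ = (φ.subst (Fml.liftSubst σ)).inst u' := by
    intro m k u τ u' hu hx
    rw [Fml.inst, Fml.inst, Fml.subst_subst, Fml.subst_subst]
    congr 1
    funext i
    rcases i with x | i
    · exact (hx x).symm
    · obtain rfl : i = 0 := Subsingleton.elim _ _
      exact hu
  have h0 := h (Tm.const 0) σ (Tm.const 0) (by simp) fun x => by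
    simp only [Fml.liftSubst, Sum.elim_inl, Tm.lift_subst]
    conv_rhs => rw [← term_subst_var (σ (Sum.inl x))]
    congr 1
    funext i
    rcases i with y | i
    · rfl
    · exact i.elim0
  have h1 := h (Tm.bvar (n := 1) 0).succ (Fml.liftSubst σ) (Tm.bvar (n := 1) 0).succ
    (by simp [Fml.liftSubst]) fun x => by
      simp only [Fml.liftSubst, Sum.elim_inl, Tm.lift_subst]
      rw [Tm.lift_eq_subst]
      congr 1
      funext i
      rcases i with y | i
      · rfl
      · exact i.elim0
  simp only [inductionAxiom, Fml.subst, ← Fml.subst_compl, h0, h1]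

/-- The induction rule makes the induction axioms valid. -/
theorem empty_mem_val_inductionAxiom {A : Fml 1} (hA : A.IsPSigma 1) :
    ∅ ∈ Val (inductionAxiom A) := by
  rw [← val_closed]
  intro E hE
  rw [Finset.union_empty]
  have hor : ∀ φ ψ : Fml 0, E ∈ perp (Val (φ.or ψ)) → E ∈ perp (Val φ) ∧ E ∈ perp (Val ψ) := by
    intro φ ψ h
    rw [← val_compl] at h ⊢
    rw [← val_compl]
    exact h
  obtain ⟨h0, h⟩ := hor _ _ hE
  obtain ⟨h1, h2⟩ := hor _ _ h
  rw [val_compl, val_closed] at h0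
  rw [← val_compl] at h1
  refine pr_of_mem_of_mem_perp (Set.mem_iInter.2 fun t => ?_) h2
  rw [← val_inst, ← val_closed]
  intro F hF
  obtain ⟨a, ha⟩ := Sequent.exists_notMem_fv (insert (Fml.all A) (F ∪ E))
  rw [Sequent.fv_insert, Set.mem_union, not_or] at ha
  refine .induction hA a t ha.2 ha.1 ((pr_of_mem_val h0).weaken ?_) ?_
    ((pr_of_mem_val (by rwa [val_compl])).weaken ?_)
  · exact Finset.insert_subset_insert _ Finset.subset_union_right
  · have h1 := Set.mem_iInter.1 h1 (Tm.fvar a)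
    have hs : Sem (A.inst (Tm.bvar (n := 1) 0).succ).compl (consSubst (Tm.fvar a) Term.var) =
        Val (A.inst (Tm.fvar a).succ).compl := by
      rw [sem_eq_val, ← Fml.subst_compl, Fml.inst_subst, Tm.succ_subst]
      rfl
    change E ∈ Sem (Fml.compl (A.and (A.inst (Tm.bvar (n := 1) 0).succ).compl))
      (consSubst (Tm.fvar a) Term.var) at h1
    rw [sem_compl, Sem, hs, ← val_inst] at h1
    refine (h1 {(A.inst (Tm.fvar a)).compl, A.inst (Tm.fvar a).succ}
      ⟨mem_sem_of_subset (compl_mem_val _) (by simp),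
        mem_sem_of_subset (mem_val_compl _) (by simp)⟩).weaken ?_
    intro x hx
    simp only [Finset.mem_union, Finset.mem_insert, Finset.mem_singleton] at hx ⊢
    tauto
  · exact Finset.insert_subset_insert _ Finset.subset_union_left

theorem sem_star_ofFree (φ : Fml 0) (σ : ℕ → Tm 0) :
    Sem φ.star (ofFree σ) = Val (φ.subst (ofFree σ)).star := by
  rw [Fml.star_subst, sem_eq_val]

theorem sem_star_inst (φ : Fml 1) (u : Tm 0) (σ : ℕ → Tm 0) :
    Sem (φ.inst u).star (ofFree σ) =
      Sem φ.star (consSubst (u.subst (ofFree σ)) (ofFree σ)) := by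
  rw [Fml.inst, Fml.star_subst, sem_subst, consSubst_ofFree]
  congr 1
  funext i
  rcases i with x | i <;> rfl

/-- A sequent which is provable from `IΣ₁(X)`, with arbitrary cuts, is valid. -/
theorem pr_of_proves {Γ : Sequent} (h : Proves (ISigma 1) Γ) (σ : ℕ → Tm 0) (E : Sequent)
    (hE : ∀ φ ∈ Γ, E ∈ perp (Sem φ.star (ofFree σ))) : Pr E := by
  have of_empty : ∀ {φ : Fml 0} {E : Sequent}, ∅ ∈ Val φ → E ∈ perp (Val φ) → Pr E :=
      fun h1 h2 => by
    have := h2 _ h1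
    rwa [Finset.empty_union] at this
  have hmono : ∀ {Γ E E' : Sequent} {σ : ℕ → Tm 0}, E ⊆ E' →
      (∀ φ ∈ Γ, E ∈ perp (Sem φ.star (ofFree σ))) →
      ∀ φ ∈ Γ, E' ∈ perp (Sem φ.star (ofFree σ)) :=
    fun hs h φ hφ => mem_perp_of_subset (h φ hφ) hs
  induction h generalizing σ E with
  | ofMem φ hφ =>
    have hE := hE φ (Finset.mem_singleton_self _)
    rw [sem_star_ofFree] at hE
    refine of_empty ?_ hE
    rcases hφ with hφ | ⟨A, hA, rfl⟩
    · rw [Fml.subst_ofFree_of_fv_eq_empty hφ.1, hφ.2.1.star_eq]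
      exact empty_mem_val_of_mem_ThN hφ
    · rw [inductionAxiom_subst, inductionAxiom_star]
      exact empty_mem_val_inductionAxiom (hA.subst _).star
  | excludedMiddle φ =>
    have h1 := hE φ (by simp)
    have h2 := hE φ.compl (by simp)
    rw [Fml.star_compl, sem_compl] at h2
    exact pr_of_mem_of_mem_perp h1 h2
  | eqRefl t =>
    have hE := hE _ (Finset.mem_singleton_self _)
    rw [sem_star_ofFree, Fml.subst_eq] at hE
    exact of_empty (φ := Fml.eq (t.subst (ofFree σ)) (t.subst (ofFree σ)))
      (empty_mem_val_of_holds trivial (.literal _ trivial) fun e b => rfl) hE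
  | eqSubst φ s t =>
    have h0 := hE (Fml.eq s t).compl (by simp)
    have h1 := hE (φ.inst s).compl (by simp)
    have h2 := hE (φ.inst t) (by simp)
    rw [Fml.star_compl, sem_compl, sem_closed] at h0 h1
    rw [sem_star_ofFree, Fml.subst_eq] at h0
    have hν : ∀ u : Tm 0, Sem (φ.inst u).star (ofFree σ) =
        Sem φ.star (instSubst (Fml.liftSubst (ofFree σ)) (u.subst (ofFree σ))) := by
      intro u
      rw [sem_star_inst, sem_eq_val, sem_instSubst]
      exact congrArg Val (Fml.subst_liftSubst_inst _ _ _).symm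
    rw [hν] at h1 h2
    have := transports_sem_star (s := s.subst (ofFree σ)) (t := t.subst (ofFree σ)) h0 φ
      (Fml.liftSubst (ofFree σ)) E h1
    rw [Finset.union_self] at this
    exact pr_of_mem_of_mem_perp this h2
  | weaken Γ Δ hs _ ih => exact ih σ E fun φ hφ => hE φ (hs hφ)
  | orLeft Γ φ ψ _ ih =>
    rw [Finset.forall_mem_insert] at hE
    refine ih σ E (Finset.forall_mem_insert _ _ _ |>.2 ⟨?_, hE.2⟩)
    have h := hE.1
    rw [← sem_compl] at h ⊢
    exact h.1
  | orRight Γ φ ψ _ ih =>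
    rw [Finset.forall_mem_insert] at hE
    refine ih σ E (Finset.forall_mem_insert _ _ _ |>.2 ⟨?_, hE.2⟩)
    have h := hE.1
    rw [← sem_compl] at h ⊢
    exact h.2
  | and Γ φ ψ _ _ ih1 ih2 =>
    rw [Finset.forall_mem_insert] at hE
    refine pr_of_mem_of_mem_perp (A := Sem (φ.and ψ).star (ofFree σ)) ⟨?_, ?_⟩ hE.1
    · rw [← sem_closed]
      exact fun F hF => ih1 σ (F ∪ E) (Finset.forall_mem_insert _ _ _ |>.2
        ⟨mem_perp_of_subset hF Finset.subset_union_left, hmono Finset.subset_union_right hE.2⟩)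
    · rw [← sem_closed]
      exact fun F hF => ih2 σ (F ∪ E) (Finset.forall_mem_insert _ _ _ |>.2
        ⟨mem_perp_of_subset hF Finset.subset_union_left, hmono Finset.subset_union_right hE.2⟩)
  | ex Γ φ u _ ih =>
    rw [Finset.forall_mem_insert] at hE
    refine ih σ E (Finset.forall_mem_insert _ _ _ |>.2 ⟨?_, hE.2⟩)
    rw [sem_star_inst]
    exact perp_anti (sem_subset_sem_ex _ _ _) hE.1
  | all Γ φ a haΓ haφ _ ih =>
    rw [Finset.forall_mem_insert] at hE
    refine pr_of_mem_of_mem_perp (A := Sem (Fml.all φ).star (ofFree σ))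
      (Set.mem_iInter.2 fun u => ?_) hE.1
    rw [← sem_closed]
    refine fun F hF => ih (Function.update σ a u) (F ∪ E)
      (Finset.forall_mem_insert _ _ _ |>.2 ⟨?_, fun ψ hψ => ?_⟩)
    · rw [sem_star_ofFree, Fml.inst_subst_update _ _ _ _ haφ, fvar_subst_update,
        Fml.subst_liftSubst_inst, Fml.star_subst, ← sem_eq_val]
      exact mem_perp_of_subset hF Finset.subset_union_left
    · rw [sem_star_ofFree, Fml.subst_ofFree_congr ψ (τ := σ), ← sem_star_ofFree]
      · exact mem_perp_of_subset (hE.2 ψ hψ) Finset.subset_union_right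
      · intro x hx
        refine Function.update_of_ne ?_ _ _
        rintro rfl
        exact haΓ (Sequent.mem_fv.2 ⟨ψ, hψ, hx⟩)
  | cut Γ φ _ _ ih1 ih2 =>
    refine ih2 σ E (Finset.forall_mem_insert _ _ _ |>.2 ⟨?_, hE⟩)
    rw [Fml.star_compl, sem_compl]
    exact fun F hF => ih1 σ (F ∪ E) (Finset.forall_mem_insert _ _ _ |>.2
      ⟨mem_perp_of_subset hF Finset.subset_union_left, hmono Finset.subset_union_right hE⟩)

/-! ### Removal of the translation -/

theorem val_memX_subset (u : Tm 0) : Val (Fml.memX u) ⊆ Val (Fml.memX u).star := by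
  intro Γ hΓ
  have triv : ∀ φ : Fml 1, φ.XFree → φ.IsDelta0 → (∀ e b, (φ.inst u).Holds ∅ e b) →
      Γ ∈ Sem φ (consSubst u Term.var) := by
    intro φ h1 h2 h3
    rw [← val_inst]
    exact mem_sem_of_subset
      (empty_mem_val_of_holds (h1.subst _) (h2.subst _) h3) (Finset.empty_subset _)
  have hr : ∀ e (b : Fin 0 → ℕ), Term.realize (Sum.elim e fun _ => u.realize (Sum.elim e b))
      u.lift = u.realize (Sum.elim e b) := by
    intro e b
    rw [Tm.lift, Term.realize_relabel]
    refine term_realize_congr u ?_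
    rintro (x | i) _
    · rfl
    · exact i.elim0
  refine sem_subset_sem_ex _ _ u ⟨triv (Fml.le (Tm.bvar 0) u.lift) trivial
    (.literal _ trivial) fun e b => ?_, triv (Fml.eq u.lift (Tm.bvar 0)) trivial
    (.literal _ trivial) fun e b => ?_, by rw [sem_eq_val]; exact hΓ⟩
  · rw [Fml.holds_inst]
    exact (hr e b).ge
  · rw [Fml.holds_inst]
    exact hr e b

/-- A proof of `TI(≺)` for the translation of `X` yields a derivation of `TI(≺)` for `X` itself: a
member of the former is equal to one of the latter, and `≺` respects equality. -/
theorem derivable_TI_of_proves {prec : ℕ → ℕ → Prop} (h : Proves (ISigma 1) (TI prec)) :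
    Derivable (TI prec) := by
  have hid : (ofFree Tm.fvar : ℕ ⊕ Fin 0 → Tm 0) = Term.var := by
    funext i
    rcases i with x | i
    · rfl
    · exact i.elim0
  have hneg : ∀ u : Tm 0, Val (Fml.nmemX u).star ⊆ Val (Fml.nmemX u) := fun u => by
    have h : Val (Fml.memX u).star.compl ⊆ Val (Fml.memX u).compl := by
      rw [val_compl, val_compl]
      exact perp_anti (val_memX_subset u)
    rwa [← Fml.star_compl] at h
  have hPr : Pr (TI prec) := by
    refine pr_of_proves h Tm.fvar _ ?_
    rw [hid]
    intro φ hφ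
    rcases Finset.mem_insert.1 hφ with rfl | hφ
    · intro Γ hΓ
      have : Γ ∈ Val (Fml.all (Fml.nmemX (Tm.bvar 0))) := by
        refine Set.mem_iInter.2 fun u => ?_
        have hu := Set.mem_iInter.1 hΓ u
        change Γ ∈ Sem (Fml.nmemX (Tm.bvar 0)).star _ at hu
        rw [sem_eq_val, ← Fml.star_subst] at hu
        rw [sem_eq_val]
        exact hneg u hu
      refine (pr_of_mem_val this).weaken ?_
      intro x hx
      simp only [TI, Finset.mem_union, Finset.mem_insert] at hx ⊢
      tauto
    · obtain rfl := Finset.mem_singleton.1 hφ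
      suffices H : {Fml.ex (progress prec)} ∈
          perp (Sem (Fml.ex (progress prec)).star Term.var) from
        mem_perp_of_subset H fun x hx => by
          rw [Finset.mem_singleton] at hx
          subst hx
          exact Finset.mem_insert_of_mem (Finset.mem_singleton_self _)
      intro Γ hΓ
      rw [Finset.union_comm]
      refine hΓ _ (Set.mem_iInter.2 fun u => fun Γ hΓ => ?_)
      -- `u` is a least element of the translated predicate, `z` a corresponding member of `X`.
      have hmem : Γ ∈ Val (Fml.memX u).star := by
        have := (Set.mem_iInter.1 hΓ (Tm.const 0)).1
        change Γ ∈ Sem (Fml.memX (Tm.bvar 1)).star _ at this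
        rwa [sem_eq_val, ← Fml.star_subst] at this
      refine (hmem (Γ ∪ {Fml.ex (progress prec)}) (Set.mem_iInter.2 fun z => fun F hF => ?_)).weaken
        (Finset.union_subset Finset.Subset.rfl Finset.subset_union_left)
      have hFX : F ∈ Val (Fml.memX z) := by
        have := hF.2.2
        rwa [sem_eq_val] at this
      have hFeq : F ∈ Val (Fml.eq u z) := by
        have := hF.2.1
        rwa [sem_eq_val, Fml.subst_eq, lift_subst_consSubst, term_subst_var] at this
      have key : Γ ∪ F ∈ Val (Fml.ex (progress prec)) := by
        refine sem_subset_sem_ex _ _ z (Set.mem_iInter.2 fun x => ⟨?_, ?_⟩)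
        · rw [sem_eq_val]
          exact mem_sem_of_subset hFX Finset.subset_union_right
        · have hψ : ∀ v : Tm 0, (Fml.lt prec x.lift (Tm.bvar 0)).compl.inst v =
              (Fml.lt prec x v).compl := by
            intro v
            rw [← Fml.inst_compl, Fml.inst, Fml.subst_lt, ← consSubst_ofFree,
              lift_subst_consSubst, hid, term_subst_var]
            rfl
          have t1 : Transports F (Val (Fml.nmemX x).star) (Val (Fml.nmemX x)) := fun _ h =>
            mem_sem_of_subset (hneg x h) Finset.subset_union_left
          have t2 := transports_val_inst (ψ := (Fml.lt prec x.lift (Tm.bvar 0)).compl) trivial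
            (.literal _ trivial) hFeq
          rw [hψ, hψ] at t2
          have hx := (Set.mem_iInter.1 hΓ x).2
          change Γ ∈ perp (perp (Sem (Fml.nmemX (Tm.bvar (n := 2) 0)).star _) ∩
            perp (Sem (Fml.lt prec (Tm.bvar (n := 2) 0) (Tm.bvar 1)).compl _)) at hx
          rw [sem_eq_val, sem_eq_val, ← Fml.star_subst, ← Fml.subst_compl, Fml.subst_lt] at hx
          have := t1.or t2 Γ hx
          change _ ∈ perp (perp (Sem (Fml.nmemX (Tm.bvar 0)) (consSubst x (consSubst z Term.var))) ∩
            perp (Sem (Fml.lt prec (Tm.bvar 0) (Tm.bvar 1)).compl _))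
          rw [sem_eq_val, sem_eq_val, ← Fml.subst_compl, Fml.subst_lt]
          exact this
      refine (pr_of_mem_val key).weaken ?_
      intro x hx
      simp only [Finset.mem_union, Finset.mem_insert, Finset.mem_singleton] at hx ⊢
      tauto
  refine hPr (fun _ => Tm.const 0) _ (by simp) fun φ hφ => ?_
  rwa [Fml.subst_ofFree_of_fv_eq_empty]
  rcases Finset.mem_insert.1 hφ with rfl | hφ
  · simp [Fml.fv]
  · obtain rfl := Finset.mem_singleton.1 hφ
    ext x
    simp [Fml.fv, Fml.lt, Fml.compl]

end TIGame

theorem mainTheorem4 (prec : ℕ → ℕ → Prop) (hprec : IsWellOrder ℕ prec) :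
    (∀ (τ : Finset (List ℕ)) (lab : List ℕ → TIGame.Sequent),
      TIGame.IsDerivation 1 τ lab (TIGame.TI prec) →
        TIGame.ProverWins prec (TIGame.treeHeight τ)) ∧
    (TIGame.Proves (TIGame.ISigma 1) (TIGame.TI prec) →
      ∃ (τ : Finset (List ℕ)) (lab : List ℕ → TIGame.Sequent),
        TIGame.IsDerivation 1 τ lab (TIGame.TI prec) ∧
          TIGame.ProverWins prec (TIGame.treeHeight τ)) := by
  have part1 : ∀ (τ : Finset (List ℕ)) (lab : List ℕ → TIGame.Sequent),
      TIGame.IsDerivation 1 τ lab (TIGame.TI prec) →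
        TIGame.ProverWins prec (TIGame.treeHeight τ) := fun _ _ h =>
    TIGame.proverWins_of_deriv (.of_isDerivation h)
  refine ⟨part1, fun h => ?_⟩
  obtain ⟨τ, lab, hD⟩ := (TIGame.derivable_TI_of_proves h).exists_isDerivation
  exact ⟨τ, lab, hD, part1 τ lab hD⟩
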